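/- Consider the planar piecewise linear differential system with switching line $\Sigma=\{x=0\}$, $$\begin{cases}\dot x=T_Lx-y\\ \dot y=D_Lx-a_L\end{cases}\ \text{for } x<0,\qquad \begin{cases}\dot x=T_Rx-y\\ \dot y=D_Rx-a_R\end{cases}\ \text{for } x>0,\tag{cf}$$ with real parameters $T_L,D_L,a_L,T_R,D_R,a_R$, and trajectories understood in the sense of Filippov. Put $$\xi=a_RT_L-a_LT_R,\qquad c_0=a_Ra_L(a_RT_L-a_LT_R),\qquad c_\infty=T_L\left(T_L^2D_R-T_R^2D_L\right).$$ *Half-maps.* The forward Poincaré half-map $y_L$ sends $y_0\ge 0$ to $y_1$ if the orbit of the left system that starts at $(0,y_0)$ stays in $\{x<0\}$ for all times $t\in(0,\tau)$ and is at $(0,y_1)$ at time $\tau$, for some $\tau>0$; moreover $y_L(0)=0$ if there are pairs $y_0>0>y_1=y_L(y_0)$ arbitrarily close to $(0,0)$. The backward half-map $y_R$ is defined in the same way with the right system, $\{x>0\}$ and times $t\in(\tau,0)$ for some $\tau<0$. A half-map exists if its domain is non-empty. *Monodromic singularities.* A point off $\Sigma$ is a monodromic singularity if it is a focus or a center of the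 linear system of its zone, that is, an equilibrium of it whose eigenvalues are not real. A point of $\Sigma$ is a monodromic singularity if it is the origin and, moreover, ($a_L>0$, or $a_L=0$ and $4D_L-T_L^2>0$) and ($a_R<0$, or $a_R=0$ and $4D_R-T_R^2>0$). *Limit cycles.* A closed orbit is the trace of a non-constant periodic trajectory. A limit cycle is a closed orbit that meets $\Sigma$, meets it only at points where both vector fields are transversal to $\Sigma$ and point to the same side, and has a neighbourhood that contains no other closed orbit. **Statement.** Suppose that $T_LT_R<0$, $c_0\neq0$, both half-maps $y_L$ and $y_R$ exist, (cf) has a unique monodromic singularity, $4D_L-T_L^2>0$ and $4D_R-T_R^2>0$. If $\xi\,c_\infty>0$, then (cf) has a limit cycle. -/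

import Mathlib

open Set MeasureTheory

/-- Parameters of the planar piecewise linear system in Liénard canonical form
`x' = TL x - y, y' = DL x - aL` for `x < 0` and `x' = TR x - y, y' = DR x - aR` for `x > 0`. -/
structure LienardPWL where
  TL : ℝ
  DL : ℝ
  aL : ℝ
  TR : ℝ
  DR : ℝ
  aR : ℝ

namespace LienardPWL

/-- The affine vector field `(x, y) ↦ (T x - y, D x - a)`. -/
def field (T D a : ℝ) (p : ℝ × ℝ) : ℝ × ℝ := (T * p.1 - p.2, D * p.1 - a)

/-- The linear part of `field T D a`. -/
def linPart (T D : ℝ) : Matrix (Fin 2) (Fin 2) ℝ := !![T, -1; D, 0]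

/-- The vector field of the left zone `x < 0`. -/
def leftField (S : LienardPWL) : ℝ × ℝ → ℝ × ℝ := field S.TL S.DL S.aL

/-- The vector field of the right zone `x > 0`. -/
def rightField (S : LienardPWL) : ℝ × ℝ → ℝ × ℝ := field S.TR S.DR S.aR

/-- The switching line `x = 0`. -/
def switchingLine : Set (ℝ × ℝ) := {p | p.1 = 0}

open Classical in
/-- The set-valued vector field of Filippov's convention: single-valued off the switching line,
and on the switching line the convex hull of the two one-sided values. -/
noncomputable def filippov (S : LienardPWL) (p : ℝ × ℝ) : Set (ℝ × ℝ) :=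
  if p.1 < 0 then {S.leftField p}
  else if 0 < p.1 then {S.rightField p}
  else segment ℝ (S.leftField p) (S.rightField p)

/-- A Filippov solution defined for all times: a locally absolutely continuous curve which
satisfies the differential inclusion at almost every time. -/
def IsSolution (S : LienardPWL) (γ : ℝ → ℝ × ℝ) : Prop :=
  (∀ a b : ℝ, AbsolutelyContinuousOnInterval γ a b) ∧
    ∀ᵐ t : ℝ, ∃ v ∈ S.filippov (γ t), HasDerivAt γ v t

/-- A (non-trivial) closed orbit: the trace of a non-constant periodic solution. -/
def IsClosedOrbit (S : LienardPWL) (Γ : Set (ℝ × ℝ)) : Prop :=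
  ∃ γ : ℝ → ℝ × ℝ, ∃ P : ℝ, S.IsSolution γ ∧ 0 < P ∧ Function.Periodic γ P ∧
    (∃ s t : ℝ, γ s ≠ γ t) ∧ Γ = range γ

/-- A point of the switching line at which both fields are transversal to the line and point
to the same side of it. -/
def IsCrossingPoint (S : LienardPWL) (p : ℝ × ℝ) : Prop :=
  p ∈ switchingLine ∧ 0 < (S.leftField p).1 * (S.rightField p).1

/-- A closed crossing orbit: it meets the switching line, and only at crossing points. -/
def IsCrossingClosedOrbit (S : LienardPWL) (Γ : Set (ℝ × ℝ)) : Prop :=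
  S.IsClosedOrbit Γ ∧ (Γ ∩ switchingLine).Nonempty ∧
    ∀ p ∈ Γ ∩ switchingLine, S.IsCrossingPoint p

/-- A limit cycle: a closed crossing orbit that is isolated from other closed orbits, that is,
some neighbourhood of it contains no other closed orbit. -/
def IsLimitCycle (S : LienardPWL) (Γ : Set (ℝ × ℝ)) : Prop :=
  S.IsCrossingClosedOrbit Γ ∧
    ∃ U : Set (ℝ × ℝ), IsOpen U ∧ Γ ⊆ U ∧ ∀ Γ' : Set (ℝ × ℝ), S.IsClosedOrbit Γ' → Γ' ⊆ U → Γ' = Γ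

/-- The orbit of `(0, y₀)` enters `x < 0` and first returns to the switching line, in forward
time, at `(0, y₁)`. -/
def ForwardReturn (S : LienardPWL) (y₀ y₁ : ℝ) : Prop :=
  ∃ φ : ℝ → ℝ × ℝ, ∃ τ : ℝ, (∀ t, HasDerivAt φ (S.leftField (φ t)) t) ∧ φ 0 = (0, y₀) ∧
    0 < τ ∧ φ τ = (0, y₁) ∧ ∀ t ∈ Ioo 0 τ, (φ t).1 < 0

/-- The orbit of `(0, y₀)` comes from `x > 0`, and in backward time it first returns to the
switching line at `(0, y₁)`. -/
def BackwardReturn (S : LienardPWL) (y₀ y₁ : ℝ) : Prop :=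
  ∃ φ : ℝ → ℝ × ℝ, ∃ τ : ℝ, (∀ t, HasDerivAt φ (S.rightField (φ t)) t) ∧ φ 0 = (0, y₀) ∧
    τ < 0 ∧ φ τ = (0, y₁) ∧ ∀ t ∈ Ioo τ 0, 0 < (φ t).1

/-- The Poincaré half-map (as a relation) built from a return relation `R`: its graph on
`y₀ ≥ 0`, together with `0 ↦ 0` when the return relation has points `(y₀, y₁)` arbitrarily
close to `(0, 0)` with `y₀ > 0 > y₁`. -/
def halfMap (R : ℝ → ℝ → Prop) (y₀ y₁ : ℝ) : Prop :=
  (0 ≤ y₀ ∧ R y₀ y₁) ∨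
    (y₀ = 0 ∧ y₁ = 0 ∧ ∀ ε > 0, ∃ u ∈ Ioo 0 ε, ∃ v ∈ Ioo (-ε) 0, R u v)

/-- The forward Poincaré half-map `y_L` exists: its domain is non-empty. -/
def ForwardHalfMapExists (S : LienardPWL) : Prop :=
  ∃ y₀ y₁ : ℝ, halfMap S.ForwardReturn y₀ y₁

/-- The backward Poincaré half-map `y_R` exists: its domain is non-empty. -/
def BackwardHalfMapExists (S : LienardPWL) : Prop :=
  ∃ y₀ y₁ : ℝ, halfMap S.BackwardReturn y₀ y₁

/-- `p` is a focus or a center of the affine field: an equilibrium at which the linear part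
has no real eigenvalue. -/
def IsFocusOrCenter (T D a : ℝ) (p : ℝ × ℝ) : Prop :=
  field T D a p = 0 ∧ spectrum ℝ (linPart T D) = ∅

/-- Monodromic singularities: foci and centers off the switching line, and the origin when
there is a half-rotation around it in both closed half-planes. -/
def IsMonodromicSingularity (S : LienardPWL) (p : ℝ × ℝ) : Prop :=
  (p.1 < 0 ∧ IsFocusOrCenter S.TL S.DL S.aL p) ∨
  (0 < p.1 ∧ IsFocusOrCenter S.TR S.DR S.aR p) ∨
  (p = 0 ∧ (0 < S.aL ∨ (S.aL = 0 ∧ 0 < 4 * S.DL - S.TL ^ 2)) ∧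
    (S.aR < 0 ∨ (S.aR = 0 ∧ 0 < 4 * S.DR - S.TR ^ 2)))

/-- `ξ = a_R T_L - a_L T_R`. -/
def xi (S : LienardPWL) : ℝ := S.aR * S.TL - S.aL * S.TR

/-- `c₀ = a_R a_L (a_R T_L - a_L T_R)`. -/
def c0 (S : LienardPWL) : ℝ := S.aR * S.aL * (S.aR * S.TL - S.aL * S.TR)

/-- `c_∞ = T_L (T_L² D_R - T_R² D_L)`. -/
def cInf (S : LienardPWL) : ℝ := S.TL * (S.TL ^ 2 * S.DR - S.TR ^ 2 * S.DL)

end LienardPWL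

/-!
The flow around a focus has the first integral `log |z| - damping * arg z`, where `z` is a complex
coordinate in which the flow is linear. Restricted to the switching line it is a *potential* with a
single minimum at `0`, so that an arc in the zone joins `(0, y₀)` to `(0, y₁)`, with `y₁ < 0 < y₀`,
exactly when the potential gains `damping * turn` from `y₀` to `y₁`: a *defect* vanishes. The
reflection `(x, t) ↦ (-x, -t)` turns the right zone into a left one, and crossing closed orbits then
correspond to the common zeros of two defects, that is, to the zeros on `y > 0` of the
*displacement*: the second defect along the arcs of the first zone.

Reversing time if necessary, let `T_L > 0`. At infinity the displacement tends to `π` times the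
difference of the dampings, which has the sign of `c_∞`. Near `0` it has the sign of `-ξ`: when both
zones rotate around the origin, the combination of the two potentials without second order term is
strictly monotone there, with derivative of the sign of `ξ`; when one of the foci lies in its own
zone, the arcs around it do not shrink to the origin and the sign is visible at once. So `ξ c_∞ > 0`
makes the displacement change sign. Being analytic, it has an isolated zero, and the corresponding
closed orbit is isolated among the closed orbits.
-/

open Filter Topology
open scoped Real NNReal Interval

namespace LienardPWL

/-- The parameters of a linear zone whose equilibrium is a focus or a center, not on the switching
line. The zone is always taken to be `x < 0`: a right zone enters through its mirror image. -/
structure Focus where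
  T : ℝ
  D : ℝ
  a : ℝ
  discr_pos : 0 < 4 * D - T ^ 2
  a_ne_zero : a ≠ 0

namespace Focus

/-! ### The first integral of a focus on the switching line -/

section Potential

variable (F : Focus) (y : ℝ)

/-- The angular velocity, that is, the imaginary part of the eigenvalues. -/
noncomputable def freq : ℝ := √(4 * F.D - F.T ^ 2) / 2

/-- The logarithmic growth of the distance to the focus per unit of angle. -/
noncomputable def damping : ℝ := F.T / 2 / F.freq

/-- In the coordinate `z = (T / 2) (x - x̄) - (y - ȳ) + i freq (x - x̄)`, in which the flow around
the focus `(x̄, ȳ)` is the multiplication by `exp ((T / 2 + i freq) t)`, the switching line is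
`Im z = -height`. -/
noncomputable def height : ℝ := F.freq * (F.a / F.D)

/-- The coordinate `Re z` of the point `(0, y)`. -/
noncomputable def offset : ℝ := F.T / 2 * (F.a / F.D) - y

/-- The squared modulus of the coordinate `z` of the point `(0, y)`. -/
noncomputable def normSq : ℝ := F.offset y ^ 2 + F.height ^ 2

/-- The angle of the point `(0, y)` as seen from the focus, measured from the normal to the
switching line. -/
noncomputable def angle : ℝ := Real.arctan (F.offset y / F.height)

/-- The first integral `log |z| - damping * arg z` of the flow, on the switching line. -/
noncomputable def potential : ℝ := Real.log (F.normSq y) / 2 - F.damping * F.angle y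

/-- The angle that an arc in `x < 0` sweeps in excess of the difference of the angles of its ends:
a full turn when the arc goes around the focus. -/
noncomputable def turn : ℝ := if 0 < F.a then 0 else 2 * π

/-- The function that vanishes at `(y₀, y₁)` when an arc in `x < 0` joins `(0, y₀)` to
`(0, y₁)`. -/
noncomputable def defect (y₀ y₁ : ℝ) : ℝ :=
  F.potential y₁ - F.potential y₀ - F.damping * F.turn

/-- The image of the focus under `(x, y, t) ↦ (x, -y, -t)`. -/
def reverse : Focus := ⟨-F.T, F.D, F.a, by simpa using F.discr_pos, F.a_ne_zero⟩

lemma D_pos : 0 < F.D := by nlinarith [sq_nonneg F.T, F.discr_pos]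

lemma freq_pos : 0 < F.freq := by
  have := F.discr_pos
  unfold freq
  positivity

lemma freq_sq : F.freq ^ 2 = F.D - F.T ^ 2 / 4 := by
  rw [freq, div_pow, Real.sq_sqrt F.discr_pos.le]
  ring

lemma damping_mul_freq : F.damping * F.freq = F.T / 2 := div_mul_cancel₀ _ F.freq_pos.ne'

lemma damping_mul_height : F.damping * F.height = F.T / 2 * (F.a / F.D) := by
  rw [height, ← mul_assoc, damping_mul_freq]

lemma height_ne_zero : F.height ≠ 0 :=
  mul_ne_zero F.freq_pos.ne' (div_ne_zero F.a_ne_zero F.D_pos.ne')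

lemma height_pos_iff : 0 < F.height ↔ 0 < F.a := by
  rw [height, mul_pos_iff_of_pos_left F.freq_pos, div_pos_iff_of_pos_right F.D_pos]

lemma height_neg_iff : F.height < 0 ↔ F.a < 0 := by
  rw [← not_iff_not, not_lt, not_lt, F.height_ne_zero.symm.le_iff_lt, F.a_ne_zero.symm.le_iff_lt,
    height_pos_iff]

lemma turn_of_pos (ha : 0 < F.a) : F.turn = 0 := if_pos ha

lemma turn_of_neg (ha : F.a < 0) : F.turn = 2 * π := if_neg ha.not_gt

lemma turn_nonneg : 0 ≤ F.turn := by
  unfold turn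
  split_ifs <;> positivity

lemma normSq_pos : 0 < F.normSq y := by
  have := F.height_ne_zero
  unfold normSq
  positivity

lemma normSq_eq : F.normSq y = (F.D * y ^ 2 - F.a * F.T * y + F.a ^ 2) / F.D := by
  have := F.D_pos.ne'
  rw [normSq, height, mul_pow, freq_sq, offset]
  field_simp
  ring

lemma hasDerivAt_offset : HasDerivAt F.offset (-1) y := (hasDerivAt_id y).const_sub _

lemma hasDerivAt_normSq : HasDerivAt F.normSq (-(2 * F.offset y)) y :=
  (((F.hasDerivAt_offset y).pow 2).add_const (F.height ^ 2)).congr_deriv (by simp)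

lemma hasDerivAt_angle : HasDerivAt F.angle (-F.height / F.normSq y) y := by
  refine ((F.hasDerivAt_offset y).div_const F.height).arctan.congr_deriv ?_
  have := F.height_ne_zero
  have := F.normSq_pos y
  have : 0 < 1 + (F.offset y / F.height) ^ 2 := by positivity
  rw [normSq] at *
  field_simp
  ring

lemma hasDerivAt_potential : HasDerivAt F.potential (y / F.normSq y) y := by
  have hm := F.normSq_pos y
  refine ((((F.hasDerivAt_normSq y).log hm.ne').div_const 2).sub
    ((F.hasDerivAt_angle y).const_mul F.damping)).congr_deriv ?_
  have hy : y = F.damping * F.height - F.offset y := by rw [damping_mul_height, offset]; ring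
  calc _ = (F.damping * F.height - F.offset y) / F.normSq y := by ring
    _ = _ := by rw [← hy]

lemma continuous_potential : Continuous F.potential :=
  continuous_iff_continuousAt.2 fun y ↦ (F.hasDerivAt_potential y).continuousAt

lemma analyticAt_potential : AnalyticAt ℝ F.potential y := by
  have ho : AnalyticAt ℝ F.offset y := analyticAt_const.sub analyticAt_id
  have hn : AnalyticAt ℝ F.normSq y := (ho.pow 2).add analyticAt_const
  have hθ : AnalyticAt ℝ F.angle y := Real.contDiff_arctan.contDiffAt.analyticAt.comp
    (ho.div analyticAt_const F.height_ne_zero)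
  exact ((hn.log (F.normSq_pos y)).div analyticAt_const two_ne_zero).sub
    (analyticAt_const.mul hθ)

lemma strictMonoOn_potential : StrictMonoOn F.potential (Ici 0) :=
  strictMonoOn_of_deriv_pos (convex_Ici 0) F.continuous_potential.continuousOn fun y hy ↦ by
    rw [(F.hasDerivAt_potential y).deriv]
    exact div_pos (by simpa using hy) (F.normSq_pos y)

lemma strictAntiOn_potential : StrictAntiOn F.potential (Iic 0) :=
  strictAntiOn_of_deriv_neg (convex_Iic 0) F.continuous_potential.continuousOn fun y hy ↦ by
    rw [(F.hasDerivAt_potential y).deriv]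
    exact div_neg_of_neg_of_pos (by simpa using hy) (F.normSq_pos y)

lemma le_of_defect_eq_zero {u u' v v' : ℝ} (hu : 0 ≤ u) (huu' : u ≤ u') (hv : v ≤ 0) (hv' : v' ≤ 0)
    (h : F.defect u v = 0) (h' : F.defect u' v' = 0) : v' ≤ v := by
  have hle := F.strictMonoOn_potential.monotoneOn hu (hu.trans huu') huu'
  rw [defect] at h h'
  exact (F.strictAntiOn_potential.le_iff_ge hv hv').1 (by linarith)

lemma freq_reverse : F.reverse.freq = F.freq := by simp [freq, reverse]

lemma damping_reverse : F.reverse.damping = -F.damping := by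
  rw [damping, freq_reverse, damping, reverse, neg_div, neg_div]

lemma height_reverse : F.reverse.height = F.height := by rw [height, freq_reverse, height, reverse]

lemma offset_reverse : F.reverse.offset (-y) = -F.offset y := by
  simp only [offset, reverse]
  ring

lemma potential_reverse : F.reverse.potential (-y) = F.potential y := by
  simp only [potential, normSq, angle, offset_reverse, height_reverse, damping_reverse, neg_sq,
    neg_div, Real.arctan_neg, neg_mul_neg]

lemma defect_reverse (y₀ y₁ : ℝ) : F.reverse.defect (-y₁) (-y₀) = -F.defect y₀ y₁ := by
  have hturn : F.reverse.turn = F.turn := rfl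
  rw [defect, defect, potential_reverse, potential_reverse, damping_reverse, hturn]
  ring

end Potential

/-! ### Behaviour of the first integral at infinity -/

section Infinity

variable (F : Focus)

lemma tendsto_offset_atTop : Tendsto F.offset atTop atBot :=
  tendsto_atBot_add_const_left _ _ tendsto_neg_atTop_atBot

lemma tendsto_offset_atBot : Tendsto F.offset atBot atTop :=
  tendsto_atTop_add_const_left _ _ tendsto_neg_atBot_atTop

lemma tendsto_angle_atTop : Tendsto F.angle atTop (𝓝 (F.turn / 2 - π / 2)) := by
  rcases F.a_ne_zero.lt_or_gt with ha | ha
  · rw [F.turn_of_neg ha, show 2 * π / 2 - π / 2 = π / 2 by ring]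
    exact (tendsto_nhds_of_tendsto_nhdsWithin Real.tendsto_arctan_atTop).comp <|
      F.tendsto_offset_atTop.atBot_mul_const_of_neg (inv_lt_zero.2 (F.height_neg_iff.2 ha))
  · rw [F.turn_of_pos ha, zero_div, zero_sub]
    exact (tendsto_nhds_of_tendsto_nhdsWithin Real.tendsto_arctan_atBot).comp <|
      F.tendsto_offset_atTop.atBot_div_const (F.height_pos_iff.2 ha)

lemma tendsto_angle_atBot : Tendsto F.angle atBot (𝓝 (π / 2 - F.turn / 2)) := by
  rcases F.a_ne_zero.lt_or_gt with ha | ha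
  · rw [F.turn_of_neg ha, show π / 2 - 2 * π / 2 = -(π / 2) by ring]
    exact (tendsto_nhds_of_tendsto_nhdsWithin Real.tendsto_arctan_atBot).comp <|
      F.tendsto_offset_atBot.atTop_mul_const_of_neg (inv_lt_zero.2 (F.height_neg_iff.2 ha))
  · rw [F.turn_of_pos ha, zero_div, sub_zero]
    exact (tendsto_nhds_of_tendsto_nhdsWithin Real.tendsto_arctan_atTop).comp <|
      F.tendsto_offset_atBot.atTop_div_const (F.height_pos_iff.2 ha)

lemma tendsto_log_normSq_sub_log {l : Filter ℝ} (hl : Tendsto (fun y : ℝ ↦ y⁻¹) l (𝓝 0))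
    (h0 : ∀ᶠ y in l, y ≠ 0) :
    Tendsto (fun y ↦ Real.log (F.normSq y) / 2 - Real.log |y|) l (𝓝 0) := by
  have hratio : Tendsto (fun y : ℝ ↦ (F.T / 2 * (F.a / F.D) * y⁻¹ - 1) ^ 2 +
      F.height ^ 2 * y⁻¹ ^ 2) l (𝓝 1) := by
    simpa using (((hl.const_mul (F.T / 2 * (F.a / F.D))).sub_const 1).pow 2).add
      ((hl.pow 2).const_mul (F.height ^ 2))
  have hlog := (((Real.continuousAt_log one_ne_zero).tendsto.comp hratio).div_const 2)
  rw [Real.log_one, zero_div] at hlog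
  refine hlog.congr' ?_
  filter_upwards [h0] with y hy
  have hquot : (F.T / 2 * (F.a / F.D) * y⁻¹ - 1) ^ 2 + F.height ^ 2 * y⁻¹ ^ 2 =
      F.normSq y / y ^ 2 := by
    rw [normSq, offset]
    field_simp
  rw [Function.comp_apply, hquot, Real.log_div (F.normSq_pos y).ne' (pow_ne_zero 2 hy),
    Real.log_pow, Real.log_abs]
  push_cast
  ring

lemma tendsto_potential_sub_log_atTop : Tendsto (fun y ↦ F.potential y - Real.log |y|) atTop
    (𝓝 (-(F.damping * (F.turn / 2 - π / 2)))) := by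
  have := (F.tendsto_log_normSq_sub_log tendsto_inv_atTop_zero (eventually_ne_atTop 0)).sub
    (F.tendsto_angle_atTop.const_mul F.damping)
  rw [zero_sub] at this
  exact this.congr fun y ↦ sub_right_comm _ _ _

lemma tendsto_potential_sub_log_atBot : Tendsto (fun y ↦ F.potential y - Real.log |y|) atBot
    (𝓝 (-(F.damping * (π / 2 - F.turn / 2)))) := by
  have := (F.tendsto_log_normSq_sub_log tendsto_inv_atBot_zero (eventually_ne_atBot 0)).sub
    (F.tendsto_angle_atBot.const_mul F.damping)
  rw [zero_sub] at this
  exact this.congr fun y ↦ sub_right_comm _ _ _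

lemma tendsto_potential_atTop : Tendsto F.potential atTop atTop :=
  (F.tendsto_potential_sub_log_atTop.add_atTop
    (Real.tendsto_log_atTop.comp tendsto_abs_atTop_atTop)).congr fun _ ↦ sub_add_cancel _ _

lemma tendsto_potential_atBot : Tendsto F.potential atBot atTop :=
  (F.tendsto_potential_sub_log_atBot.add_atTop
    (Real.tendsto_log_atTop.comp tendsto_abs_atBot_atTop)).congr fun _ ↦ sub_add_cancel _ _

lemma tendsto_defect_sub_log :
    Tendsto (fun p : ℝ × ℝ ↦ F.defect p.1 p.2 - (Real.log |p.2| - Real.log |p.1|))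
      (atTop ×ˢ atBot) (𝓝 (-(F.damping * π))) := by
  have := ((F.tendsto_potential_sub_log_atBot.comp tendsto_snd).sub
    (F.tendsto_potential_sub_log_atTop.comp tendsto_fst)).sub_const (F.damping * F.turn)
  convert this using 2
  · simp only [defect, Function.comp_apply]
    ring
  · ring

lemma exists_neg_potential_eq {e : ℝ} (he : F.potential 0 < e) : ∃ y < 0, F.potential y = e := by
  obtain ⟨m, hm0, hm⟩ := ((eventually_lt_atBot (0 : ℝ)).and
    (F.tendsto_potential_atBot.eventually_gt_atTop e)).exists
  obtain ⟨y, hy, rfl⟩ := intermediate_value_Ioo' hm0.le F.continuous_potential.continuousOn ⟨he, hm⟩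
  exact ⟨y, hy.2, rfl⟩

end Infinity

/-! ### Arcs around an expanding focus -/

section Displacement

variable {F G : Focus} {y v : ℝ}

variable (F) in
/-- The point of the half-line `y < 0` at which `F.defect y` vanishes: the end of the arc from
`(0, y)`. The value is meaningless when there is no such point. -/
noncomputable def arcEnd (y : ℝ) : ℝ :=
  Function.invFunOn F.potential (Iio 0) (F.potential y + F.damping * F.turn)

variable (F G) in
/-- The defect of `G` along the arcs of `F`; its zeros are the ordinates of the closed orbits made
of an arc of `F` and one of `G`. -/
noncomputable def displacement (y : ℝ) : ℝ := G.defect y (F.arcEnd y)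

lemma damping_pos (hT : 0 < F.T) : 0 < F.damping := div_pos (half_pos hT) F.freq_pos

lemma arcEnd_eq (hv : v < 0) (h : F.defect y v = 0) : F.arcEnd y = v := by
  rw [defect, sub_sub, sub_eq_zero] at h
  rw [arcEnd, ← h]
  exact (F.strictAntiOn_potential.injOn.mono Iio_subset_Iic_self).leftInvOn_invFunOn hv

lemma exists_neg_potential_eq_add (hT : 0 < F.T) (hy : 0 < y) :
    ∃ v ∈ Iio 0, F.potential v = F.potential y + F.damping * F.turn := by
  refine F.exists_neg_potential_eq ?_
  have h0 := F.strictMonoOn_potential self_mem_Ici hy.le hy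
  have := mul_nonneg (damping_pos hT).le F.turn_nonneg
  linarith

lemma arcEnd_neg (hT : 0 < F.T) (hy : 0 < y) : F.arcEnd y < 0 :=
  Function.invFunOn_mem (exists_neg_potential_eq_add hT hy)

lemma potential_arcEnd (hT : 0 < F.T) (hy : 0 < y) :
    F.potential (F.arcEnd y) = F.potential y + F.damping * F.turn :=
  Function.invFunOn_eq (exists_neg_potential_eq_add hT hy)

lemma defect_arcEnd (hT : 0 < F.T) (hy : 0 < y) : F.defect y (F.arcEnd y) = 0 := by
  rw [defect, potential_arcEnd hT hy]
  ring

lemma analyticAt_arcEnd (hT : 0 < F.T) (hy : 0 < y) : AnalyticAt ℝ F.arcEnd y := by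
  set v := F.arcEnd y
  set e : ℝ → ℝ := fun u ↦ F.potential u + F.damping * F.turn
  have hv : v < 0 := arcEnd_neg hT hy
  have hpot := F.analyticAt_potential v
  have hderiv : deriv F.potential v ≠ 0 := by
    rw [(F.hasDerivAt_potential v).deriv]
    exact div_ne_zero hv.ne (F.normSq_pos v).ne'
  set g := hpot.hasStrictDerivAt.localInverse _ _ _ hderiv
  have hev : e y = F.potential v := (potential_arcEnd hT hy).symm
  have hgv : g (e y) = v := by
    rw [hev]
    exact HasStrictFDerivAt.localInverse_apply_image ..
  have hg : AnalyticAt ℝ g (e y) := hev ▸ hpot.analyticAt_localInverse hderiv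
  have he : AnalyticAt ℝ e y := (F.analyticAt_potential y).add analyticAt_const
  have hright : ∀ᶠ x in 𝓝 (e y), F.potential (g x) = x := by
    rw [hev]
    exact HasStrictDerivAt.eventually_right_inverse hpot.hasStrictDerivAt hderiv
  have hneg : ∀ᶠ u in 𝓝 y, g (e u) < 0 :=
    (hg.comp he).continuousAt.eventually (gt_mem_nhds (hgv.trans_lt hv))
  refine (hg.comp he).congr ?_
  filter_upwards [he.continuousAt.eventually hright, hneg] with u hpu hgu
  refine (arcEnd_eq hgu ?_).symm
  rw [defect, hpu]
  ring

lemma analyticOnNhd_displacement (hT : 0 < F.T) :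
    AnalyticOnNhd ℝ (displacement F G) (Ioi 0) := fun y hy ↦
  ((AnalyticAt.comp (G.analyticAt_potential _) (analyticAt_arcEnd hT hy)).sub
    (G.analyticAt_potential y)).sub analyticAt_const

lemma tendsto_arcEnd_atTop (hT : 0 < F.T) : Tendsto F.arcEnd atTop atBot := by
  refine tendsto_atBot.2 fun b ↦ ?_
  filter_upwards [(tendsto_atTop_add_const_right _ (F.damping * F.turn)
    F.tendsto_potential_atTop).eventually_ge_atTop (F.potential (min b 0)),
    eventually_gt_atTop 0] with y hle hy
  rw [← potential_arcEnd hT hy,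
    F.strictAntiOn_potential.le_iff_ge (min_le_right b 0) (arcEnd_neg hT hy).le] at hle
  exact hle.trans (min_le_left b 0)

lemma tendsto_displacement_atTop (hT : 0 < F.T) :
    Tendsto (displacement F G) atTop (𝓝 ((F.damping - G.damping) * π)) := by
  have harc : Tendsto (fun y ↦ (y, F.arcEnd y)) atTop (atTop ×ˢ atBot) :=
    tendsto_id.prodMk (tendsto_arcEnd_atTop hT)
  have hlim := (G.tendsto_defect_sub_log.comp harc).sub (F.tendsto_defect_sub_log.comp harc)
  rw [show -(G.damping * π) - -(F.damping * π) = (F.damping - G.damping) * π by ring] at hlim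
  refine hlim.congr' ?_
  filter_upwards [eventually_gt_atTop 0] with y hy
  simp only [Function.comp_apply, defect_arcEnd hT hy, displacement]
  ring

lemma eventually_displacement_pos_of_neg_of_pos (hT : 0 < F.T) (hF : F.a < 0) (hG : 0 < G.a) :
    ∀ᶠ y in 𝓝[>] 0, 0 < displacement F G y := by
  have hturn : 0 < F.damping * F.turn := by
    rw [F.turn_of_neg hF]
    exact mul_pos (damping_pos hT) Real.two_pi_pos
  obtain ⟨v, hv, hpv⟩ := F.exists_neg_potential_eq (lt_add_of_pos_right (F.potential 0) hturn)
  have hGv : G.potential 0 < G.potential v := G.strictAntiOn_potential hv.le self_mem_Iic hv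
  filter_upwards [nhdsWithin_le_nhds (G.continuous_potential.continuousAt.eventually
    (gt_mem_nhds hGv)), self_mem_nhdsWithin] with y hGy hy
  have hpot := F.strictMonoOn_potential self_mem_Ici (mem_Ici.2 (le_of_lt hy)) hy
  have harc : F.arcEnd y < v := by
    rw [← F.strictAntiOn_potential.lt_iff_gt hv.le (arcEnd_neg hT hy).le, hpv,
      potential_arcEnd hT hy]
    linarith
  have := G.strictAntiOn_potential (arcEnd_neg hT hy).le hv.le harc
  rw [displacement, defect, G.turn_of_pos hG]
  linarith

/-- The ratio `F.normSq 0 / G.normSq 0` cancels the terms of second order at `0`. -/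
lemma hasDerivAt_potential_sub (y : ℝ) :
    HasDerivAt (fun y ↦ (F.a * G.T - G.a * F.T) *
        (G.potential y - F.normSq 0 / G.normSq 0 * F.potential y))
      (y ^ 2 * ((F.a * G.T - G.a * F.T) * (1 - F.normSq 0 / G.normSq 0) * y +
        F.a * (F.a * G.T - G.a * F.T) ^ 2 / (G.a * F.D)) / (F.normSq y * G.normSq y)) y := by
  have hF := F.normSq_pos y
  have hG := G.normSq_pos y
  have := F.D_pos
  have := G.D_pos
  have := F.a_ne_zero
  have := G.a_ne_zero
  set ξ := F.a * G.T - G.a * F.T with hξ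
  set r := F.normSq 0 / G.normSq 0 with hr
  have hcubic : y ^ 2 * (ξ * (1 - r) * y + F.a * ξ ^ 2 / (G.a * F.D)) =
      ξ * (y * F.normSq y - r * y * G.normSq y) := by
    simp only [hr, hξ, normSq_eq]
    field_simp
    ring
  refine (((G.hasDerivAt_potential y).sub
    ((F.hasDerivAt_potential y).const_mul r)).const_mul ξ).congr_deriv ?_
  rw [hcubic]
  field_simp

lemma exists_strictMonoOn_potential_sub (hF : 0 < F.a) (hG : 0 < G.a)
    (hξ : F.a * G.T - G.a * F.T ≠ 0) :
    ∃ δ > 0, StrictMonoOn (fun y ↦ (F.a * G.T - G.a * F.T) *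
      (G.potential y - F.normSq 0 / G.normSq 0 * F.potential y)) (Icc (-δ) δ) := by
  have := F.D_pos
  have hH := hasDerivAt_potential_sub (F := F) (G := G)
  set ξ := F.a * G.T - G.a * F.T
  set r := F.normSq 0 / G.normSq 0
  set m := F.a * ξ ^ 2 / (G.a * F.D)
  set H : ℝ → ℝ := fun y ↦ ξ * (G.potential y - r * F.potential y)
  have hm0 : 0 < ξ * (1 - r) * 0 + m := by
    rw [mul_zero, zero_add]
    positivity
  have hlin : Continuous fun y ↦ ξ * (1 - r) * y + m := by fun_prop
  obtain ⟨δ, hδ, hpos⟩ := Metric.eventually_nhds_iff_ball.1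
    (hlin.continuousAt.eventually (lt_mem_nhds hm0))
  have hcont : Continuous H := continuous_iff_continuousAt.2 fun y ↦ (hH y).continuousAt
  have hderiv {y} (hy : y ∈ Ioo (-δ) δ) (hy0 : y ≠ 0) : 0 < deriv H y := by
    have := hpos y (by rwa [Real.ball_eq_Ioo, zero_sub, zero_add])
    have := F.normSq_pos y
    have := G.normSq_pos y
    rw [(hH y).deriv]
    positivity
  refine ⟨δ, hδ, ?_⟩
  rw [← Icc_union_Icc_eq_Icc (neg_nonpos.2 hδ.le) hδ.le]
  refine (strictMonoOn_of_deriv_pos (convex_Icc (-δ) 0) hcont.continuousOn fun y hy ↦ ?_).union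
    (strictMonoOn_of_deriv_pos (convex_Icc 0 δ) hcont.continuousOn fun y hy ↦ ?_)
    (isGreatest_Icc (neg_nonpos.2 hδ.le)) (isLeast_Icc hδ.le)
  all_goals rw [interior_Icc] at hy
  · exact hderiv ⟨hy.1, hy.2.trans hδ⟩ hy.2.ne
  · exact hderiv ⟨(neg_lt_zero.2 hδ).trans hy.1, hy.2⟩ hy.1.ne'

lemma eventually_displacement_mul_neg_of_pos (hT : 0 < F.T) (hF : 0 < F.a) (hG : 0 < G.a)
    (hξ : F.a * G.T - G.a * F.T ≠ 0) :
    ∀ᶠ y in 𝓝[>] 0, (F.a * G.T - G.a * F.T) * displacement F G y < 0 := by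
  obtain ⟨δ, hδ, hmono⟩ := exists_strictMonoOn_potential_sub hF hG hξ
  have hFδ : F.potential 0 < F.potential (-δ) :=
    F.strictAntiOn_potential (neg_nonpos.2 hδ.le) self_mem_Iic (neg_lt_zero.2 hδ)
  filter_upwards [nhdsWithin_le_nhds (F.continuous_potential.continuousAt.eventually
    (gt_mem_nhds hFδ)), Ioo_mem_nhdsGT hδ] with y hFy hy
  have hneg := arcEnd_neg hT hy.1
  have hpot : F.potential (F.arcEnd y) = F.potential y := by
    rw [potential_arcEnd hT hy.1, F.turn_of_pos hF, mul_zero, add_zero]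
  have harc : -δ < F.arcEnd y := by
    rwa [← F.strictAntiOn_potential.lt_iff_gt hneg.le (neg_nonpos.2 hδ.le), hpot]
  have hlt := hmono ⟨harc.le, hneg.le.trans hδ.le⟩ ⟨(hneg.trans hy.1).le.trans' harc.le, hy.2.le⟩
    (hneg.trans hy.1)
  simp only [hpot] at hlt
  rw [displacement, defect, G.turn_of_pos hG]
  linarith

lemma eventually_displacement_mul_neg (hFT : 0 < F.T) (hGT : 0 < G.T) (hG : 0 < G.a)
    (hξ : F.a * G.T - G.a * F.T ≠ 0) :
    ∀ᶠ y in 𝓝[>] 0, (F.a * G.T - G.a * F.T) * displacement F G y < 0 := by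
  rcases F.a_ne_zero.lt_or_gt with hF | hF
  · have hneg : F.a * G.T - G.a * F.T < 0 :=
      sub_neg.2 ((mul_neg_of_neg_of_pos hF hGT).trans (mul_pos hG hFT))
    filter_upwards [eventually_displacement_pos_of_neg_of_pos hFT hF hG] with y hy
    exact mul_neg_of_neg_of_pos hneg hy
  · exact eventually_displacement_mul_neg_of_pos hFT hF hG hξ

lemma damping_sub_mul_pos (hF : 0 < F.T) (hG : 0 < G.T) {s : ℝ}
    (hs : 0 < s * (F.T * (F.T ^ 2 * G.D - G.T ^ 2 * F.D))) :
    0 < s * (F.damping - G.damping) := by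
  have := F.freq_pos
  have := G.freq_pos
  have := damping_pos hF
  have := damping_pos hG
  have hfactor : F.T * (F.T ^ 2 * G.D - G.T ^ 2 * F.D) = (F.damping - G.damping) *
      ((F.damping + G.damping) * (4 * F.T * F.freq ^ 2 * G.freq ^ 2)) := by
    calc _ = F.T * (F.T ^ 2 * (G.D - G.T ^ 2 / 4) - G.T ^ 2 * (F.D - F.T ^ 2 / 4)) := by ring
      _ = F.T * (F.T ^ 2 * G.freq ^ 2 - G.T ^ 2 * F.freq ^ 2) := by rw [freq_sq, freq_sq]
      _ = _ := by
        rw [damping, damping]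
        field_simp
        ring
  rw [hfactor, ← mul_assoc] at hs
  exact pos_of_mul_pos_left hs (by positivity)

end Displacement

/-! ### Isolated common zeros of two defects -/

section CommonZero

variable {F G : Focus}

/-- The pairs `y₀ > 0 > y₁` such that the arcs of `F` and of `G` that start at `(0, y₀)` both end
at `(0, y₁)`. -/
def commonZeros (F G : Focus) : Set (ℝ × ℝ) :=
  {p | 0 < p.1 ∧ p.2 < 0 ∧ F.defect p.1 p.2 = 0 ∧ G.defect p.1 p.2 = 0}

/-- Some common zero of the two defects has a neighbourhood without other common zeros. -/
def HasIsolatedCommonZero (F G : Focus) : Prop :=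
  ∃ p ∈ commonZeros F G, ∀ᶠ q in 𝓝 p, q ∈ commonZeros F G → q = p

lemma commonZeros_comm : commonZeros F G = commonZeros G F := by
  ext p
  simp only [commonZeros, mem_ofPred_eq, and_comm (a := F.defect _ _ = 0)]

lemma HasIsolatedCommonZero.symm (h : HasIsolatedCommonZero F G) : HasIsolatedCommonZero G F := by
  rwa [HasIsolatedCommonZero, commonZeros_comm]

lemma mem_commonZeros_reverse {u v : ℝ} :
    (-v, -u) ∈ commonZeros F.reverse G.reverse ↔ (u, v) ∈ commonZeros F G := by
  simp only [commonZeros, mem_ofPred_eq, defect_reverse, neg_eq_zero, neg_pos, neg_lt_zero,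
    and_left_comm (a := v < 0)]

lemma HasIsolatedCommonZero.of_reverse (h : HasIsolatedCommonZero F.reverse G.reverse) :
    HasIsolatedCommonZero F G := by
  obtain ⟨⟨u, v⟩, hmem, hiso⟩ := h
  refine ⟨(-v, -u), mem_commonZeros_reverse.1 (by simpa using hmem), ?_⟩
  have hcont : Continuous fun q : ℝ × ℝ ↦ (-q.2, -q.1) := by fun_prop
  have hlim : Tendsto (fun q : ℝ × ℝ ↦ (-q.2, -q.1)) (𝓝 (-v, -u)) (𝓝 (u, v)) :=
    hcont.tendsto' _ _ (by simp only [neg_neg])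
  filter_upwards [hlim.eventually hiso] with q hq hqmem
  have := hq (mem_commonZeros_reverse.2 hqmem)
  grind

lemma hasIsolatedCommonZero_of_sign_change (hT : 0 < F.T) {u v : ℝ} (hu : 0 < u) (hv : 0 < v)
    (hneg : displacement F G u < 0) (hpos : 0 < displacement F G v) :
    HasIsolatedCommonZero F G := by
  have han := analyticOnNhd_displacement (G := G) hT
  obtain ⟨y, hy, hzero⟩ := isPreconnected_Ioi.intermediate_value (mem_Ioi.2 hu) (mem_Ioi.2 hv)
    han.continuousOn ⟨hneg.le, hpos.le⟩
  have hiso : ∀ᶠ x in 𝓝[≠] y, displacement F G x ≠ 0 := by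
    by_contra h
    exact hpos.ne' (han.eqOn_zero_of_preconnected_of_frequently_eq_zero isPreconnected_Ioi hy h hv)
  refine ⟨(y, F.arcEnd y), ⟨hy, arcEnd_neg hT hy, defect_arcEnd hT hy, hzero⟩, ?_⟩
  filter_upwards [continuousAt_fst.eventually (eventually_nhdsWithin_iff.1 hiso)]
    with q hq ⟨_, hq2, hF, hG⟩
  have harc := arcEnd_eq hq2 hF
  have hqy : q.1 = y := by
    by_contra hne
    exact hq hne (by rwa [displacement, harc])
  exact Prod.ext hqy (by rw [← harc, hqy])

lemma hasIsolatedCommonZero_of_pos (hFT : 0 < F.T) (hGT : 0 < G.T) (hG : 0 < G.a)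
    (hξ : 0 < (F.a * G.T - G.a * F.T) * (F.T * (F.T ^ 2 * G.D - G.T ^ 2 * F.D))) :
    HasIsolatedCommonZero F G := by
  have hξ0 : F.a * G.T - G.a * F.T ≠ 0 := left_ne_zero_of_mul hξ.ne'
  have hlim := (tendsto_displacement_atTop (G := G) hFT).const_mul (F.a * G.T - G.a * F.T)
  have hlim_pos : 0 < (F.a * G.T - G.a * F.T) * ((F.damping - G.damping) * π) := by
    rw [← mul_assoc]
    exact mul_pos (damping_sub_mul_pos hFT hGT hξ) Real.pi_pos
  obtain ⟨u, hu, hu0⟩ :=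
    ((hlim.eventually (lt_mem_nhds hlim_pos)).and (eventually_gt_atTop 0)).exists
  obtain ⟨v, hv, hv0⟩ :=
    ((eventually_displacement_mul_neg hFT hGT hG hξ0).and self_mem_nhdsWithin).exists
  rcases hξ0.lt_or_gt with h | h
  · exact hasIsolatedCommonZero_of_sign_change hFT hu0 hv0 (neg_of_mul_pos_right hu h.le)
      (pos_of_mul_neg_right hv h.le)
  · exact hasIsolatedCommonZero_of_sign_change hFT hv0 hu0 (neg_of_mul_neg_right hv h.le)
      (pos_of_mul_pos_right hu h.le)

theorem hasIsolatedCommonZero (hT : 0 < F.T * G.T) (ha : 0 < F.a ∨ 0 < G.a)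
    (hξ : 0 < (F.a * G.T - G.a * F.T) * (F.T * (F.T ^ 2 * G.D - G.T ^ 2 * F.D))) :
    HasIsolatedCommonZero F G := by
  wlog hFT : 0 < F.T generalizing F G
  · have hneg : F.T < 0 := (not_lt.1 hFT).lt_of_ne (left_ne_zero_of_mul hT.ne')
    refine .of_reverse (this ?_ ha ?_ (neg_pos.2 hneg))
    · exact hT.trans_eq (neg_mul_neg _ _).symm
    · exact hξ.trans_eq (by simp only [reverse]; ring)
  have hGT : 0 < G.T := pos_of_mul_pos_right hT hFT.le
  rcases ha with hF | hG
  · refine (hasIsolatedCommonZero_of_pos hGT hFT hF ?_).symm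
    refine pos_of_mul_pos_right (a := F.T) ((mul_pos hGT hξ).trans_eq ?_) hFT.le
    ring
  · exact hasIsolatedCommonZero_of_pos hFT hGT hG hξ

end CommonZero

end Focus

/-! ### First returns -/

section FirstReturn

variable {x : ℝ → ℝ} {d t₀ t : ℝ}

lemma eventually_neg_of_hasDerivAt_neg (hd : HasDerivAt x d t₀) (hneg : d < 0) (h0 : x t₀ = 0) :
    ∀ᶠ s in 𝓝[>] t₀, x s < 0 := by
  have := eventually_nhdsWithin_sign_eq_of_deriv_neg (by rwa [hd.deriv]) h0
  filter_upwards [nhdsWithin_le_nhds this, self_mem_nhdsWithin] with s hs hs'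
  rw [← sign_eq_neg_one_iff, hs, sign_eq_neg_one_iff]
  exact sub_neg.2 hs'

lemma eventually_pos_of_hasDerivAt_neg (hd : HasDerivAt x d t₀) (hneg : d < 0) (h0 : x t₀ = 0) :
    ∀ᶠ s in 𝓝[<] t₀, 0 < x s := by
  have := eventually_nhdsWithin_sign_eq_of_deriv_neg (by rwa [hd.deriv]) h0
  filter_upwards [nhdsWithin_le_nhds this, self_mem_nhdsWithin] with s hs hs'
  rw [← sign_eq_one_iff, hs, sign_eq_one_iff]
  exact sub_pos.2 hs'

lemma exists_first_return (hx : Continuous x) (hneg : ∀ᶠ s in 𝓝[>] t₀, x s < 0) (ht : t₀ < t)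
    (hxt : 0 ≤ x t) : ∃ s ∈ Ioc t₀ t, x s = 0 ∧ ∀ r ∈ Ioo t₀ s, x r < 0 := by
  obtain ⟨u, hu, hneg'⟩ := mem_nhdsGT_iff_exists_Ioo_subset.1 hneg
  have hu' : t₀ < u := hu
  obtain ⟨m, hm, hmu⟩ := exists_between (lt_min hu' ht)
  have hK : IsCompact (Icc m t ∩ x ⁻¹' Ici 0) :=
    isCompact_Icc.inter_right (isClosed_Ici.preimage hx)
  obtain ⟨s, ⟨hs, hxs⟩, hleast⟩ := hK.exists_isLeast
    ⟨t, ⟨(hmu.trans_le (min_le_right _ _)).le, le_rfl⟩, hxt⟩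
  have hts : t₀ < s := hm.trans_le hs.1
  have hlt : ∀ r ∈ Ioo t₀ s, x r < 0 := fun r hr ↦ by
    by_contra! h
    rcases lt_or_ge r m with hrm | hrm
    · exact h.not_gt (hneg' ⟨hr.1, hrm.trans (hmu.trans_le (min_le_left _ _))⟩)
    · exact hr.2.not_ge (hleast ⟨⟨hrm, hr.2.le.trans hs.2⟩, h⟩)
  refine ⟨s, ⟨hts, hs.2⟩, le_antisymm ?_ hxs, hlt⟩
  refine le_of_tendsto (hx.continuousWithinAt (s := Iio s) (x := s)).tendsto ?_
  filter_upwards [Ioo_mem_nhdsLT hts] with r hr using (hlt r hr).le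

end FirstReturn

lemma hasDerivAt_fst {f : ℝ → ℝ × ℝ} {v : ℝ × ℝ} {t : ℝ} (h : HasDerivAt f v t) :
    HasDerivAt (fun t ↦ (f t).1) v.1 t :=
  (hasFDerivAt_fst (𝕜 := ℝ) (p := f t)).comp_hasDerivAt t h

lemma hasDerivAt_snd {f : ℝ → ℝ × ℝ} {v : ℝ × ℝ} {t : ℝ} (h : HasDerivAt f v t) :
    HasDerivAt (fun t ↦ (f t).2) v.2 t :=
  (hasFDerivAt_snd (𝕜 := ℝ) (p := f t)).comp_hasDerivAt t h

namespace Focus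

/-! ### Arcs in the zone of the focus -/

section Arc

variable (F : Focus) (y : ℝ)

/-- The logarithmic spiral `exp (damping * θ) * cos θ`, to which the flow reduces the distance to
the vertical line through the focus, `θ` being the angle around the focus. -/
noncomputable def spiral (θ : ℝ) : ℝ := Real.exp (F.damping * θ) * Real.cos θ

/-- The angle around the focus, at time `t`, of the orbit starting at `(0, y)`. -/
noncomputable def phase (t : ℝ) : ℝ := F.angle y + F.freq * t

/-- The orbit of the linear system starting at `(0, y)`. -/
noncomputable def orbit (t : ℝ) : ℝ × ℝ :=
  let r := Real.exp (F.T / 2 * t) / Real.cos (F.angle y)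
  (F.a / F.D * (1 - r * Real.cos (F.phase y t)),
    F.T / 2 * (F.a / F.D) * (2 - r * Real.cos (F.phase y t)) -
      F.height * (r * Real.sin (F.phase y t)))

/-- The orbit of `(0, y₀)` is at `(0, y₁)` at time `τ > 0` after having stayed in `x < 0`. -/
def IsArc (y₀ y₁ τ : ℝ) : Prop :=
  0 < τ ∧ F.orbit y₀ τ = (0, y₁) ∧ ∀ t ∈ Ioo 0 τ, (F.orbit y₀ t).1 < 0

lemma cos_angle_pos : 0 < Real.cos (F.angle y) := Real.cos_arctan_pos _

lemma height_mul_tan_angle : F.height * Real.tan (F.angle y) = F.offset y := by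
  rw [angle, Real.tan_arctan, mul_div_cancel₀ _ F.height_ne_zero]

lemma angle_lt_angle_of_pos (ha : 0 < F.a) {u v : ℝ} (h : v < u) : F.angle u < F.angle v :=
  Real.arctan_strictMono <|
    div_lt_div_of_pos_right (sub_lt_sub_left h _) (F.height_pos_iff.2 ha)

lemma angle_le_angle_of_neg (ha : F.a < 0) {u v : ℝ} (h : u ≤ v) : F.angle u ≤ F.angle v :=
  Real.arctan_strictMono.monotone <|
    div_le_div_of_nonpos_of_le (F.height_neg_iff.2 ha).le (sub_le_sub_left h _)

lemma spiral_pos_iff {θ : ℝ} : 0 < F.spiral θ ↔ 0 < Real.cos θ :=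
  mul_pos_iff_of_pos_left (Real.exp_pos _)

lemma spiral_angle_pos : 0 < F.spiral (F.angle y) := F.spiral_pos_iff.2 (F.cos_angle_pos y)

lemma spiral_add_two_pi (θ : ℝ) :
    F.spiral (θ + 2 * π) = Real.exp (F.damping * (2 * π)) * F.spiral θ := by
  rw [spiral, spiral, Real.cos_add_two_pi, mul_add, Real.exp_add]
  ring

lemma log_spiral_angle :
    Real.log (F.spiral (F.angle y)) = Real.log |F.height| - F.potential y := by
  have hc := F.cos_angle_pos y
  have hh := F.height_ne_zero
  have hnorm : F.normSq y = (F.height / Real.cos (F.angle y)) ^ 2 := by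
    rw [normSq, ← height_mul_tan_angle, Real.tan_eq_sin_div_cos]
    field_simp
    rw [Real.sin_sq_add_cos_sq]
  rw [spiral, Real.log_mul (Real.exp_pos _).ne' hc.ne', Real.log_exp, potential, hnorm,
    Real.log_pow, Real.log_div hh hc.ne', Real.log_abs]
  push_cast
  ring

lemma potential_eq_iff_spiral_eq {u v : ℝ} :
    F.potential u = F.potential v ↔ F.spiral (F.angle u) = F.spiral (F.angle v) := by
  rw [← Real.log_injOn_pos.eq_iff (F.spiral_angle_pos u) (F.spiral_angle_pos v),
    log_spiral_angle, log_spiral_angle, sub_right_inj]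

lemma defect_eq_zero_iff {y₀ y₁ : ℝ} :
    F.defect y₀ y₁ = 0 ↔ F.spiral (F.angle y₁ + F.turn) = F.spiral (F.angle y₀) := by
  have hturn : F.spiral (F.angle y₁ + F.turn) =
      Real.exp (F.damping * F.turn) * F.spiral (F.angle y₁) := by
    rcases F.a_ne_zero.lt_or_gt with ha | ha
    · rw [F.turn_of_neg ha, spiral_add_two_pi]
    · simp [F.turn_of_pos ha]
  rw [hturn, ← Real.log_injOn_pos.eq_iff
    (mem_Ioi.2 (mul_pos (Real.exp_pos _) (F.spiral_angle_pos y₁))) (F.spiral_angle_pos y₀),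
    Real.log_mul (Real.exp_pos _).ne' (F.spiral_angle_pos y₁).ne', Real.log_exp, log_spiral_angle,
    log_spiral_angle, defect]
  constructor <;> intro h <;> linarith

lemma orbit_zero : F.orbit y 0 = (0, y) := by
  have hc := (F.cos_angle_pos y).ne'
  have hy := F.height_mul_tan_angle y
  rw [Real.tan_eq_sin_div_cos, offset] at hy
  simp only [orbit, phase, mul_zero, Real.exp_zero, add_zero, one_div, inv_mul_cancel₀ hc, sub_self,
    Prod.mk.injEq, true_and]
  linear_combination -hy

lemma hasDerivAt_orbit (t : ℝ) :
    HasDerivAt (F.orbit y) (field F.T F.D F.a (F.orbit y t)) t := by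
  have hphase : HasDerivAt (F.phase y) F.freq t :=
    (((hasDerivAt_id t).const_mul F.freq).const_add (F.angle y)).congr_deriv (mul_one _)
  have hexp : HasDerivAt (fun t ↦ Real.exp (F.T / 2 * t) / Real.cos (F.angle y))
      (F.T / 2 * (Real.exp (F.T / 2 * t) / Real.cos (F.angle y))) t := by
    refine ((((hasDerivAt_id t).const_mul (F.T / 2)).exp).div_const _).congr_deriv ?_
    simp only [id, mul_one]
    ring
  have hcos := hexp.mul hphase.cos
  have hsin := hexp.mul hphase.sin
  refine (((hcos.const_sub 1).const_mul (F.a / F.D)).prodMk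
    (((hcos.const_sub 2).const_mul (F.T / 2 * (F.a / F.D))).sub
      (hsin.const_mul F.height))).congr_deriv ?_
  have hD := mul_div_cancel₀ F.a F.D_pos.ne'
  have hfreq := F.freq_sq
  simp only [field, orbit, height, Prod.mk.injEq]
  constructor
  · ring
  · linear_combination (-(F.a / F.D) * (Real.exp (F.T / 2 * t) / Real.cos (F.angle y)) *
      Real.cos (F.phase y t)) * hfreq - hD

lemma orbit_fst (t : ℝ) : (F.orbit y t).1 =
    F.a / F.D / F.spiral (F.angle y) * (F.spiral (F.angle y) - F.spiral (F.phase y t)) := by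
  have hexp : Real.exp (F.damping * F.phase y t) =
      Real.exp (F.damping * F.angle y) * Real.exp (F.T / 2 * t) := by
    rw [← Real.exp_add, phase, mul_add, ← mul_assoc, damping_mul_freq]
  have := (F.cos_angle_pos y).ne'
  rw [mul_sub, div_mul_cancel₀ _ (F.spiral_angle_pos y).ne', orbit, spiral, spiral, hexp]
  field_simp

lemma orbit_fst_neg_iff_of_pos (ha : 0 < F.a) (t : ℝ) :
    (F.orbit y t).1 < 0 ↔ F.spiral (F.angle y) < F.spiral (F.phase y t) := by
  rw [orbit_fst, ← smul_eq_mul, smul_neg_iff_of_pos_left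
    (div_pos (div_pos ha F.D_pos) (F.spiral_angle_pos y)), sub_neg]

lemma orbit_fst_neg_iff_of_neg (ha : F.a < 0) (t : ℝ) :
    (F.orbit y t).1 < 0 ↔ F.spiral (F.phase y t) < F.spiral (F.angle y) := by
  rw [orbit_fst, ← smul_eq_mul, smul_neg_iff_of_neg_left
    (div_neg_of_neg_of_pos (div_neg_of_neg_of_pos ha F.D_pos) (F.spiral_angle_pos y)), sub_pos]

lemma orbit_fst_eq_zero_iff (t : ℝ) :
    (F.orbit y t).1 = 0 ↔ F.spiral (F.phase y t) = F.spiral (F.angle y) := by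
  rw [orbit_fst, mul_eq_zero_iff_left (div_ne_zero (div_ne_zero F.a_ne_zero F.D_pos.ne')
    (F.spiral_angle_pos y).ne'), sub_eq_zero, eq_comm]

end Arc

section IsArc

variable {F : Focus} {y₀ y₁ τ : ℝ}

lemma IsArc.spiral_phase (h : F.IsArc y₀ y₁ τ) : F.spiral (F.phase y₀ τ) = F.spiral (F.angle y₀) :=
  (F.orbit_fst_eq_zero_iff y₀ τ).1 (by rw [h.2.1])

lemma IsArc.cos_phase_pos (h : F.IsArc y₀ y₁ τ) : 0 < Real.cos (F.phase y₀ τ) :=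
  F.spiral_pos_iff.1 (h.spiral_phase ▸ F.spiral_angle_pos y₀)

lemma IsArc.angle_lt_phase (h : F.IsArc y₀ y₁ τ) : F.angle y₀ < F.phase y₀ τ :=
  lt_add_of_pos_right _ (mul_pos F.freq_pos h.1)

lemma IsArc.exists_phase_eq (h : F.IsArc y₀ y₁ τ) {θ : ℝ}
    (hθ : θ ∈ Ioo (F.angle y₀) (F.phase y₀ τ)) :
    F.phase y₀ ((θ - F.angle y₀) / F.freq) = θ ∧
      (F.orbit y₀ ((θ - F.angle y₀) / F.freq)).1 < 0 := by
  have hfreq := F.freq_pos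
  refine ⟨by rw [phase]; field_simp; ring, h.2.2 _ ⟨div_pos (sub_pos.2 hθ.1) hfreq, ?_⟩⟩
  rw [div_lt_iff₀ hfreq, sub_lt_iff_lt_add', mul_comm τ]
  exact hθ.2

lemma IsArc.height_mul_tan_phase (h : F.IsArc y₀ y₁ τ) :
    F.height * Real.tan (F.phase y₀ τ) = F.offset y₁ := by
  have hend := h.2.1
  simp only [orbit, Prod.mk.injEq, mul_eq_zero, (div_ne_zero F.a_ne_zero F.D_pos.ne'), false_or,
    sub_eq_zero] at hend
  obtain ⟨hx, hy⟩ := hend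
  have hcos := h.cos_phase_pos.ne'
  rw [← hx] at hy
  rw [← hy, offset, Real.tan_eq_sin_div_cos, div_eq_mul_inv,
    ← eq_inv_of_mul_eq_one_left hx.symm]
  ring

lemma IsArc.angle_eq_arctan_tan (h : F.IsArc y₀ y₁ τ) :
    F.angle y₁ = Real.arctan (Real.tan (F.phase y₀ τ)) := by
  rw [angle, ← h.height_mul_tan_phase, mul_div_cancel_left₀ _ F.height_ne_zero]

lemma IsArc.angle_eq_phase (h : F.IsArc y₀ y₁ τ) (hlt : F.phase y₀ τ < π / 2) :
    F.angle y₁ = F.phase y₀ τ := by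
  rw [h.angle_eq_arctan_tan, Real.arctan_tan ((Real.neg_pi_div_two_lt_arctan _).trans
    h.angle_lt_phase) hlt]

lemma IsArc.phase_lt_of_pos (h : F.IsArc y₀ y₁ τ) (ha : 0 < F.a) : F.phase y₀ τ < π / 2 := by
  by_contra! hle
  have hne : F.phase y₀ τ ≠ π / 2 := fun h0 ↦ by simpa [h0] using h.cos_phase_pos
  obtain ⟨hphase, hneg⟩ := h.exists_phase_eq ⟨Real.arctan_lt_pi_div_two _, hle.lt_of_ne' hne⟩
  rw [F.orbit_fst_neg_iff_of_pos y₀ ha, hphase] at hneg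
  simpa using F.spiral_pos_iff.1 ((F.spiral_angle_pos y₀).trans hneg)

lemma IsArc.phase_le_of_neg (h : F.IsArc y₀ y₁ τ) (ha : F.a < 0) :
    F.phase y₀ τ ≤ F.angle y₀ + 2 * π := by
  by_contra! hlt
  have hpos := F.spiral_angle_pos y₀
  rcases le_total 0 F.damping with hk | hk
  · obtain ⟨hphase, hneg⟩ := h.exists_phase_eq ⟨lt_add_of_pos_right _ Real.two_pi_pos, hlt⟩
    rw [F.orbit_fst_neg_iff_of_neg y₀ ha, hphase, spiral_add_two_pi] at hneg
    have : 1 ≤ Real.exp (F.damping * (2 * π)) := Real.one_le_exp (by positivity)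
    nlinarith
  · obtain ⟨hphase, hneg⟩ := h.exists_phase_eq (θ := F.phase y₀ τ - 2 * π)
      ⟨lt_sub_iff_add_lt.2 hlt, sub_lt_self _ Real.two_pi_pos⟩
    rw [F.orbit_fst_neg_iff_of_neg y₀ ha, hphase] at hneg
    have hturn := F.spiral_add_two_pi (F.phase y₀ τ - 2 * π)
    rw [sub_add_cancel, h.spiral_phase] at hturn
    have : Real.exp (F.damping * (2 * π)) ≤ 1 :=
      Real.exp_le_one_iff.2 (mul_nonpos_of_nonpos_of_nonneg hk Real.two_pi_pos.le)
    have : 0 < Real.exp (F.damping * (2 * π)) := Real.exp_pos _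
    nlinarith

lemma IsArc.pi_div_two_lt_phase_of_neg (h : F.IsArc y₀ y₁ τ) (ha : F.a < 0) (hy₀ : 0 ≤ y₀) :
    π / 2 < F.phase y₀ τ := by
  have hne : F.phase y₀ τ ≠ π / 2 := fun h0 ↦ by simpa [h0] using h.cos_phase_pos
  by_contra! hle
  have hangle := h.angle_eq_phase (hle.lt_of_ne hne)
  have hlt : y₀ < y₁ := by
    by_contra! hle'
    exact ((F.angle_le_angle_of_neg ha hle').trans_lt h.angle_lt_phase).ne hangle
  exact (F.strictMonoOn_potential hy₀ (hy₀.trans hlt.le) hlt).ne'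
    (F.potential_eq_iff_spiral_eq.2 (hangle ▸ h.spiral_phase))

lemma IsArc.phase_eq (h : F.IsArc y₀ y₁ τ) (hy₀ : 0 ≤ y₀) :
    F.phase y₀ τ = F.angle y₁ + F.turn := by
  rcases F.a_ne_zero.lt_or_gt with ha | ha
  · have hlow := h.pi_div_two_lt_phase_of_neg ha hy₀
    have hupp : F.phase y₀ τ - 2 * π < π / 2 := by
      linarith [h.phase_le_of_neg ha, Real.arctan_lt_pi_div_two (F.offset y₀ / F.height),
        show F.angle y₀ = Real.arctan _ from rfl]
    have hcos : -(π / 2) < F.phase y₀ τ - 2 * π := by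
      by_contra! hle
      refine h.cos_phase_pos.not_ge (Real.cos_nonpos_of_pi_div_two_le_of_le hlow.le ?_)
      linarith
    rw [F.turn_of_neg ha, h.angle_eq_arctan_tan, ← Real.tan_sub_nat_mul_pi _ 2, Nat.cast_ofNat,
      Real.arctan_tan hcos hupp, sub_add_cancel]
  · rw [F.turn_of_pos ha, add_zero, h.angle_eq_phase (h.phase_lt_of_pos ha)]

lemma IsArc.defect_eq_zero (h : F.IsArc y₀ y₁ τ) (hy₀ : 0 ≤ y₀) : F.defect y₀ y₁ = 0 :=
  F.defect_eq_zero_iff.2 (h.phase_eq hy₀ ▸ h.spiral_phase)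

lemma angle_lt_angle_add_turn (hy₁ : y₁ < y₀) : F.angle y₀ < F.angle y₁ + F.turn := by
  rcases F.a_ne_zero.lt_or_gt with ha | ha
  · have := Real.arctan_lt_pi_div_two (F.offset y₀ / F.height)
    have := Real.neg_pi_div_two_lt_arctan (F.offset y₁ / F.height)
    rw [F.turn_of_neg ha, angle, angle]
    linarith [Real.pi_pos]
  · rw [F.turn_of_pos ha, add_zero]
    exact F.angle_lt_angle_of_pos ha hy₁

lemma eventually_orbit_fst_neg (hy₀ : 0 < y₀) : ∀ᶠ t in 𝓝[>] 0, (F.orbit y₀ t).1 < 0 :=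
  eventually_neg_of_hasDerivAt_neg (hasDerivAt_fst (F.hasDerivAt_orbit y₀ 0))
    (by simpa [orbit_zero, field] using hy₀) (by rw [orbit_zero])

lemma continuous_orbit (y : ℝ) : Continuous (F.orbit y) :=
  continuous_iff_continuousAt.2 fun t ↦ (F.hasDerivAt_orbit y t).continuousAt

lemma IsArc.nonpos (h : F.IsArc y₀ y₁ τ) : y₁ ≤ 0 := by
  by_contra! hpos
  have hd := hasDerivAt_fst (F.hasDerivAt_orbit y₀ τ)
  rw [h.2.1] at hd
  obtain ⟨t, hpos, ht⟩ := ((eventually_pos_of_hasDerivAt_neg hd (by simpa [field] using hpos)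
    (by rw [h.2.1])).and (Ioo_mem_nhdsLT h.1)).exists
  exact hpos.not_gt (h.2.2 t ht)

lemma exists_isArc (hy₀ : 0 < y₀) (hy₁ : y₁ < 0) (h : F.defect y₀ y₁ = 0) :
    ∃ τ, F.IsArc y₀ y₁ τ := by
  have hfreq := F.freq_pos
  set σ := (F.angle y₁ + F.turn - F.angle y₀) / F.freq
  have hσ : 0 < σ := div_pos (sub_pos.2 (angle_lt_angle_add_turn (hy₁.trans hy₀))) hfreq
  have hreturn : (F.orbit y₀ σ).1 = 0 := by
    rw [orbit_fst_eq_zero_iff, phase, mul_div_cancel₀ _ hfreq.ne', add_sub_cancel,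
      F.defect_eq_zero_iff.1 h]
  obtain ⟨τ, ⟨hτ, -⟩, hzero, hneg⟩ := exists_first_return
    (continuous_fst.comp (F.continuous_orbit y₀)) (eventually_orbit_fst_neg hy₀) hσ hreturn.ge
  have harc : F.IsArc y₀ (F.orbit y₀ τ).2 τ := ⟨hτ, Prod.ext hzero rfl, hneg⟩
  have hdefect := harc.defect_eq_zero hy₀.le
  rw [defect] at h hdefect
  rw [F.strictAntiOn_potential.injOn hy₁.le harc.nonpos (by linarith)]
  exact ⟨τ, harc⟩

end IsArc

end Focus

/-! ### Affine fields -/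

section Field

variable {T D a : ℝ}

lemma lipschitzWith_field (T D a : ℝ) : ∃ K, LipschitzWith K (field T D a) := by
  let A : ℝ × ℝ →L[ℝ] ℝ × ℝ :=
    (T • ContinuousLinearMap.fst ℝ ℝ ℝ - ContinuousLinearMap.snd ℝ ℝ ℝ).prod
      (D • ContinuousLinearMap.fst ℝ ℝ ℝ)
  have hA : field T D a = fun p ↦ A p - (0, a) := by
    ext p <;> simp [A, field]
  rw [hA]
  exact ⟨_, A.lipschitz.sub (LipschitzWith.const _)⟩

lemma continuous_field (T D a : ℝ) : Continuous (field T D a) :=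
  (lipschitzWith_field T D a).choose_spec.continuous

lemma hasDerivWithinAt_Ici_of_hasDerivAt_Ioo {E : Type*} [NormedAddCommGroup E] [NormedSpace ℝ E]
    {v : E → E} (hv : Continuous v) {f : ℝ → E} {s u : ℝ} (hf : ContinuousOn f (Icc s u))
    (hd : ∀ t ∈ Ioo s u, HasDerivAt f (v (f t)) t) :
    ∀ t ∈ Ico s u, HasDerivWithinAt f (v (f t)) (Ici t) t := by
  intro t ht
  have hsub : Ioo t u ⊆ Ioo s u := Ioo_subset_Ioo_left ht.1
  have hcont : ContinuousWithinAt f (Ioo t u) t :=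
    (hf t (Ico_subset_Icc_self ht)).mono (hsub.trans Ioo_subset_Icc_self)
  have hnhds : Ioo t u ∈ 𝓝[>] t := Ioo_mem_nhdsGT ht.2
  refine hasDerivWithinAt_Ici_of_tendsto_deriv
    (fun r hr ↦ (hd r (hsub hr)).differentiableAt.differentiableWithinAt) hcont hnhds ?_
  have hlim := (hv.tendsto (f t)).comp hcont.tendsto
  rw [nhdsWithin_Ioo_eq_nhdsGT ht.2] at hlim
  refine hlim.congr' ?_
  filter_upwards [hnhds] with r hr using (hd r (hsub hr)).deriv.symm

lemma eqOn_of_hasDerivAt_field {f g : ℝ → ℝ × ℝ} {s u : ℝ} (hf : ContinuousOn f (Icc s u))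
    (hg : ContinuousOn g (Icc s u)) (hf' : ∀ t ∈ Ioo s u, HasDerivAt f (field T D a (f t)) t)
    (hg' : ∀ t ∈ Ioo s u, HasDerivAt g (field T D a (g t)) t) (hs : f s = g s) :
    EqOn f g (Icc s u) := by
  obtain ⟨K, hK⟩ := lipschitzWith_field T D a
  exact ODE_solution_unique (fun _ ↦ hK) hf
    (hasDerivWithinAt_Ici_of_hasDerivAt_Ioo hK.continuous hf hf') hg
    (hasDerivWithinAt_Ici_of_hasDerivAt_Ioo hK.continuous hg hg') hs

/-- A quadratic form in the velocity of the linear system, which grows at the rate `T` along the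
orbits. -/
def energy (T D a : ℝ) (p : ℝ × ℝ) : ℝ :=
  D * (field T D a p).1 ^ 2 - T * (field T D a p).1 * (field T D a p).2 + (field T D a p).2 ^ 2

lemma field_eq_zero_of_energy_eq_zero (hTD : 0 < 4 * D - T ^ 2) {p : ℝ × ℝ}
    (hp : energy T D a p = 0) : field T D a p = 0 := by
  set v := field T D a p with hv
  have hsum : (2 * v.2 - T * v.1) ^ 2 + (4 * D - T ^ 2) * v.1 ^ 2 = 0 := by
    rw [energy, ← hv] at hp
    linear_combination 4 * hp
  obtain ⟨hsq, hfst⟩ := (add_eq_zero_iff_of_nonneg (sq_nonneg _)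
    (mul_nonneg hTD.le (sq_nonneg _))).1 hsum
  have hv1 : v.1 = 0 := pow_eq_zero_iff two_ne_zero |>.1 ((mul_eq_zero.1 hfst).resolve_left hTD.ne')
  have hv2 : v.2 = 0 := by simpa [hv1] using hsq
  exact Prod.ext hv1 hv2

lemma hasDerivAt_energy {γ : ℝ → ℝ × ℝ} {t : ℝ} (hγ : HasDerivAt γ (field T D a (γ t)) t) :
    HasDerivAt (fun t ↦ energy T D a (γ t)) (T * energy T D a (γ t)) t := by
  have hw := ((hasDerivAt_fst hγ).const_mul T).sub (hasDerivAt_snd hγ)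
  have hu := ((hasDerivAt_fst hγ).const_mul D).sub_const a
  refine ((((hw.pow 2).const_mul D).sub ((hw.const_mul T).mul hu)).add (hu.pow 2)).congr_deriv ?_
  simp only [energy, field, Pi.sub_apply]
  ring

lemma eq_of_periodic_of_hasDerivAt_field (hTD : 0 < 4 * D - T ^ 2) (hT : T ≠ 0) {γ : ℝ → ℝ × ℝ}
    (hγ : ∀ t, HasDerivAt γ (field T D a (γ t)) t) {P : ℝ} (hP : P ≠ 0)
    (hper : Function.Periodic γ P) (s t : ℝ) : γ s = γ t := by
  have hderiv : ∀ t, HasDerivAt (fun t ↦ Real.exp (-T * t) * energy T D a (γ t)) 0 t := fun t ↦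
    ((((hasDerivAt_id t).const_mul (-T)).exp).mul (hasDerivAt_energy (hγ t))).congr_deriv
      (by simp only [id]; ring)
  have hfield : ∀ t, field T D a (γ t) = 0 := fun t ↦ by
    refine field_eq_zero_of_energy_eq_zero hTD ?_
    have hshift := is_const_of_deriv_eq_zero (fun t ↦ (hderiv t).differentiableAt)
      (fun t ↦ (hderiv t).deriv) (t + P) t
    rw [hper, mul_eq_mul_right_iff, Real.exp_eq_exp] at hshift
    exact hshift.resolve_left fun h ↦ mul_ne_zero hT hP (by linarith)
  exact is_const_of_deriv_eq_zero (fun t ↦ (hγ t).differentiableAt)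
    (fun t ↦ by rw [(hγ t).deriv, hfield]) s t

end Field

/-! ### Regularity of Filippov solutions -/

lemma hasDerivAt_of_ae_hasDerivAt {E : Type*} [NormedAddCommGroup E] [NormedSpace ℝ E]
    [CompleteSpace E] {f g : ℝ → E} (hf : ∀ a b, AbsolutelyContinuousOnInterval f a b)
    (hg : Continuous g) {t : ℝ} {U : Set ℝ} (hU : U ∈ 𝓝 t)
    (hd : ∀ᵐ s, s ∈ U → HasDerivAt f (g s) s) : HasDerivAt f (g t) t := by
  obtain ⟨a, b, hmem, hnhds, hsub⟩ := exists_Icc_mem_subset_of_mem_nhds hU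
  have hab : uIcc a b = Icc a b := uIcc_of_le (hmem.1.trans hmem.2)
  have hG : ∀ s, HasDerivAt (fun s ↦ ∫ r in a..s, g r) (g s) s := fun s ↦
    (hg.integral_hasStrictDerivAt a s).hasDerivAt
  have hGac : AbsolutelyContinuousOnInterval (fun s ↦ ∫ r in a..s, g r) a b := by
    refine ContDiffOn.absolutelyContinuousOnInterval (ContDiff.contDiffOn ?_)
    refine contDiff_one_iff_deriv.2 ⟨fun s ↦ (hG s).differentiableAt, ?_⟩
    rwa [funext fun s ↦ (hG s).deriv]
  obtain ⟨c, hc⟩ := ((hf a b).sub hGac).const_of_ae_hasDerivAt_zero (by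
    filter_upwards [hd] with s hs hs'
    simpa using (hs (hsub (hab ▸ hs'))).sub (hG s))
  refine ((hG t).add_const c).congr_of_eventuallyEq ?_
  filter_upwards [hnhds] with s hs
  rw [← hc s (hab ▸ hs), Pi.sub_apply, add_sub_cancel]

lemma absolutelyContinuousOnInterval_fst {f : ℝ → ℝ × ℝ} {a b : ℝ}
    (hf : AbsolutelyContinuousOnInterval f a b) :
    AbsolutelyContinuousOnInterval (fun t ↦ (f t).1) a b := by
  rw [absolutelyContinuousOnInterval_iff] at hf ⊢
  intro ε hε
  obtain ⟨δ, hδ, h⟩ := hf ε hε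
  refine ⟨δ, hδ, fun E hE hl ↦ lt_of_le_of_lt ?_ (h E hE hl)⟩
  exact Finset.sum_le_sum fun i _ ↦ le_max_left _ _

section Classical

variable {S : LienardPWL} {γ : ℝ → ℝ × ℝ} {t : ℝ}

/-- A curve that solves the two linear systems in the classical sense off the switching line, and
meets the line with the horizontal velocity `-y` that the two fields share there. -/
structure IsClassicalSolution (S : LienardPWL) (γ : ℝ → ℝ × ℝ) : Prop where
  continuous : Continuous γ
  cross : ∀ t, (γ t).1 = 0 → HasDerivAt (fun t ↦ (γ t).1) (-(γ t).2) t
  left : ∀ t, (γ t).1 < 0 → HasDerivAt γ (S.leftField (γ t)) t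
  right : ∀ t, 0 < (γ t).1 → HasDerivAt γ (S.rightField (γ t)) t

lemma filippov_of_neg {p : ℝ × ℝ} (hp : p.1 < 0) : S.filippov p = {S.leftField p} := if_pos hp

lemma filippov_of_pos {p : ℝ × ℝ} (hp : 0 < p.1) : S.filippov p = {S.rightField p} := by
  rw [filippov, if_neg hp.not_gt, if_pos hp]

lemma fst_of_mem_filippov {p v : ℝ × ℝ} (hv : v ∈ S.filippov p) :
    v.1 = S.TL * min p.1 0 + S.TR * max p.1 0 - p.2 := by
  rcases lt_trichotomy p.1 0 with hp | hp | hp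
  · rw [filippov_of_neg hp, mem_singleton_iff] at hv
    simp [hv, hp.le, leftField, field]
  · rw [filippov, if_neg hp.not_lt, if_neg hp.not_gt] at hv
    obtain ⟨a, b, -, -, hab, rfl⟩ := hv
    simp only [leftField, rightField, field, hp, Prod.fst_add, Prod.smul_fst, smul_eq_mul,
      min_self, max_self]
    linear_combination (-p.2) * hab
  · rw [filippov_of_pos hp, mem_singleton_iff] at hv
    simp [hv, hp.le, rightField, field]

lemma IsSolution.continuous (h : S.IsSolution γ) : Continuous γ :=
  continuous_iff_continuousAt.2 fun t ↦ by
    refine (h.1 (t - 1) (t + 1)).continuousOn.continuousAt ?_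
    rw [uIcc_of_le (by linarith)]
    exact Icc_mem_nhds (by linarith) (by linarith)

lemma IsSolution.hasDerivAt_of_eventually (h : S.IsSolution γ) {v : ℝ × ℝ → ℝ × ℝ}
    (hv : Continuous v) (hev : ∀ᶠ s in 𝓝 t, S.filippov (γ s) = {v (γ s)}) :
    HasDerivAt γ (v (γ t)) t := by
  refine hasDerivAt_of_ae_hasDerivAt h.1 (hv.comp h.continuous) hev ?_
  filter_upwards [h.2] with s ⟨w, hw, hd⟩ hs
  rw [show S.filippov (γ s) = _ from hs, mem_singleton_iff] at hw
  rwa [hw] at hd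

lemma IsSolution.hasDerivAt_fst (h : S.IsSolution γ) (t : ℝ) : HasDerivAt (fun t ↦ (γ t).1)
    (S.TL * min (γ t).1 0 + S.TR * max (γ t).1 0 - (γ t).2) t := by
  have hc := h.continuous
  refine hasDerivAt_of_ae_hasDerivAt (fun a b ↦ absolutelyContinuousOnInterval_fst (h.1 a b))
    (g := fun t ↦ S.TL * min (γ t).1 0 + S.TR * max (γ t).1 0 - (γ t).2) (by fun_prop) univ_mem ?_
  filter_upwards [h.2] with s ⟨v, hv, hd⟩ _
  exact (LienardPWL.hasDerivAt_fst hd).congr_deriv (fst_of_mem_filippov hv)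

lemma IsSolution.isClassicalSolution (h : S.IsSolution γ) : S.IsClassicalSolution γ where
  continuous := h.continuous
  cross t ht := (h.hasDerivAt_fst t).congr_deriv (by simp [ht])
  left t ht := h.hasDerivAt_of_eventually (continuous_field _ _ _) <|
    (h.continuous.fst.continuousAt.eventually (gt_mem_nhds ht)).mono fun _ ↦ filippov_of_neg
  right t ht := h.hasDerivAt_of_eventually (continuous_field _ _ _) <|
    (h.continuous.fst.continuousAt.eventually (lt_mem_nhds ht)).mono fun _ ↦ filippov_of_pos

end Classical

/-! ### Uniqueness away from the origin -/

section Uniqueness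

variable {S : LienardPWL} {γ δ : ℝ → ℝ × ℝ} {t : ℝ}

lemma IsClassicalSolution.comp_add_const (h : S.IsClassicalSolution γ) (c : ℝ) :
    S.IsClassicalSolution fun t ↦ γ (t + c) where
  continuous := h.continuous.comp (continuous_add_const c)
  cross t ht := (h.cross (t + c) ht).comp_add_const t c
  left t ht := (h.left (t + c) ht).comp_add_const t c
  right t ht := (h.right (t + c) ht).comp_add_const t c

lemma IsClassicalSolution.eventually_neg (h : S.IsClassicalSolution γ)
    (ht : (γ t).1 < 0 ∨ (γ t).1 = 0 ∧ 0 < (γ t).2) : ∀ᶠ s in 𝓝[>] t, (γ s).1 < 0 := by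
  rcases ht with ht | ⟨ht, hy⟩
  · exact nhdsWithin_le_nhds (h.continuous.fst.continuousAt.eventually (gt_mem_nhds ht))
  · exact eventually_neg_of_hasDerivAt_neg (h.cross t ht) (neg_neg_of_pos hy) ht

lemma IsClassicalSolution.eventually_pos (h : S.IsClassicalSolution γ)
    (ht : 0 < (γ t).1 ∨ (γ t).1 = 0 ∧ (γ t).2 < 0) : ∀ᶠ s in 𝓝[>] t, 0 < (γ s).1 := by
  rcases ht with ht | ⟨ht, hy⟩
  · exact nhdsWithin_le_nhds (h.continuous.fst.continuousAt.eventually (lt_mem_nhds ht))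
  · exact (eventually_neg_of_hasDerivAt_neg (h.cross t ht).neg (by simpa using hy)
      (by simp [ht])).mono fun _ ↦ neg_neg_iff_pos.1

lemma neg_or_pos_of_ne_zero {p : ℝ × ℝ} (hp : p ≠ 0) :
    (p.1 < 0 ∨ p.1 = 0 ∧ 0 < p.2) ∨ (0 < p.1 ∨ p.1 = 0 ∧ p.2 < 0) := by
  rcases lt_trichotomy p.1 0 with h | h | h
  · exact .inl (.inl h)
  · exact (lt_or_gt_of_ne fun hy ↦ hp (Prod.ext h hy)).symm.imp (fun hy ↦ .inr ⟨h, hy⟩)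
      fun hy ↦ .inr ⟨h, hy⟩
  · exact .inr (.inl h)

lemma IsClassicalSolution.exists_eqOn_Icc (h : S.IsClassicalSolution γ)
    (h' : S.IsClassicalSolution δ) (heq : γ t = δ t) (hne : γ t ≠ 0) :
    ∃ u > t, EqOn γ δ (Icc t u) := by
  rcases neg_or_pos_of_ne_zero hne with ht | ht
  · obtain ⟨u, hu, hneg⟩ := mem_nhdsGT_iff_exists_Ioo_subset.1
      ((h.eventually_neg ht).and (h'.eventually_neg (heq ▸ ht)))
    exact ⟨u, hu, eqOn_of_hasDerivAt_field h.continuous.continuousOn h'.continuous.continuousOn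
      (fun s hs ↦ h.left s (hneg hs).1) (fun s hs ↦ h'.left s (hneg hs).2) heq⟩
  · obtain ⟨u, hu, hpos⟩ := mem_nhdsGT_iff_exists_Ioo_subset.1
      ((h.eventually_pos ht).and (h'.eventually_pos (heq ▸ ht)))
    exact ⟨u, hu, eqOn_of_hasDerivAt_field h.continuous.continuousOn h'.continuous.continuousOn
      (fun s hs ↦ h.right s (hpos hs).1) (fun s hs ↦ h'.right s (hpos hs).2) heq⟩

lemma IsClassicalSolution.eqOn_Ici (h : S.IsClassicalSolution γ) (h' : S.IsClassicalSolution δ)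
    (hne : ∀ t, γ t ≠ 0) (heq : γ t = δ t) : EqOn γ δ (Ici t) := by
  intro b hb
  refine IsClosed.Icc_subset_of_forall_exists_gt (s := {s | γ s = δ s})
    ((isClosed_eq h.continuous h'.continuous).inter isClosed_Icc) heq (fun s hs r hr ↦ ?_)
    (right_mem_Icc.2 hb)
  obtain ⟨u, hu, heqOn⟩ := h.exists_eqOn_Icc h' hs.1 (hne s)
  exact ⟨min u r, heqOn ⟨(lt_min hu hr).le, min_le_left _ _⟩, lt_min hu hr, min_le_right _ _⟩

lemma range_eq_image_Ici {α : Type*} {f : ℝ → α} {P : ℝ} (hf : Function.Periodic f P) (hP : 0 < P)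
    (a : ℝ) : range f = f '' Ici a :=
  ((hf.image_Icc hP a).ge.trans (image_mono Icc_subset_Ici_self)).antisymm (image_subset_range _ _)

lemma IsClassicalSolution.range_eq (h : S.IsClassicalSolution γ) (h' : S.IsClassicalSolution δ)
    (hne : ∀ t, γ t ≠ 0) {P Q : ℝ} (hP : 0 < P) (hQ : 0 < Q) (hγ : Function.Periodic γ P)
    (hδ : Function.Periodic δ Q) {p : ℝ × ℝ} (hpγ : p ∈ range γ) (hpδ : p ∈ range δ) :
    range γ = range δ := by
  obtain ⟨s, rfl⟩ := hpγ
  obtain ⟨u, hu⟩ := hpδ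
  have heq := (h.comp_add_const s).eqOn_Ici (h'.comp_add_const u) (fun t ↦ hne _) (t := 0)
    (by simp [hu])
  calc range γ = (fun t ↦ γ (t + s)) '' Ici 0 := by
        rw [range_eq_image_Ici hγ hP s, ← image_image γ (· + s), image_add_const_Ici, zero_add]
    _ = (fun t ↦ δ (t + u)) '' Ici 0 := heq.image_eq
    _ = range δ := by
        rw [range_eq_image_Ici hδ hQ u, ← image_image δ (· + u), image_add_const_Ici, zero_add]

end Uniqueness

/-! ### Excursions of closed orbits -/

section Excursion

/-- The system with the zone `L` in `x < 0` and the mirror image of the zone `R` in `x > 0`. -/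
def glue (L R : Focus) : LienardPWL := ⟨L.T, L.D, L.a, -R.T, R.D, -R.a⟩

/-- The mirror image of a curve in the switching line, run backwards. It exchanges the solutions of
`glue L R` and `glue R L`. -/
def mirror (γ : ℝ → ℝ × ℝ) (t : ℝ) : ℝ × ℝ := (-(γ (-t)).1, (γ (-t)).2)

/-- The curve leaves the switching line at time `t` for `x < 0` and is back for the first time at
time `u`. -/
def IsExcursion (γ : ℝ → ℝ × ℝ) (t u : ℝ) : Prop :=
  t < u ∧ (γ t).1 = 0 ∧ (γ u).1 = 0 ∧ ∀ s ∈ Ioo t u, (γ s).1 < 0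

variable {L R : Focus} {S : LienardPWL} {γ : ℝ → ℝ × ℝ} {v : ℝ × ℝ} {t u P : ℝ}

lemma mirror_ne_zero (h : γ (-t) ≠ 0) : mirror γ t ≠ 0 := by
  simpa [mirror, Prod.ext_iff] using h

lemma leftField_glue_mirror (p : ℝ × ℝ) : (glue R L).leftField (-p.1, p.2) =
    (((glue L R).rightField p).1, -((glue L R).rightField p).2) := by
  ext <;> simp only [leftField, rightField, field, glue] <;> ring

lemma rightField_glue_mirror (p : ℝ × ℝ) : (glue R L).rightField (-p.1, p.2) =
    (((glue L R).leftField p).1, -((glue L R).leftField p).2) := by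
  ext <;> simp only [leftField, rightField, field, glue] <;> ring

lemma hasDerivAt_mirror (h : HasDerivAt γ v (-t)) : HasDerivAt (mirror γ) (v.1, -v.2) t := by
  have hneg : HasDerivAt (fun t ↦ γ (-t)) (-v) t := by
    simpa using! h.scomp t (hasDerivAt_neg t)
  simpa using! (hasDerivAt_fst hneg).neg.prodMk (hasDerivAt_snd hneg)

lemma mirror_periodic (h : Function.Periodic γ P) : Function.Periodic (mirror γ) P := fun t ↦ by
  simp only [mirror, neg_add, ← sub_eq_add_neg, h.sub_eq]

lemma IsClassicalSolution.mirror (h : (glue L R).IsClassicalSolution γ) :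
    (glue R L).IsClassicalSolution (mirror γ) where
  continuous := by
    have := h.continuous
    unfold LienardPWL.mirror
    fun_prop
  cross t ht := by
    have h0 : (γ (-t)).1 = 0 := neg_eq_zero.1 ht
    simpa [LienardPWL.mirror] using! ((h.cross (-t) h0).scomp t (hasDerivAt_neg t)).neg
  left t ht := (hasDerivAt_mirror (h.right (-t) (neg_neg_iff_pos.1 ht))).congr_deriv
    (leftField_glue_mirror _).symm
  right t ht := (hasDerivAt_mirror (h.left (-t) (neg_pos.1 ht))).congr_deriv
    (rightField_glue_mirror _).symm

lemma IsExcursion.isArc (he : IsExcursion γ t u) (h : (glue L R).IsClassicalSolution γ) :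
    L.IsArc (γ t).2 (γ u).2 (u - t) := by
  obtain ⟨htu, ht, hu, hneg⟩ := he
  have hmem : ∀ s ∈ Ioo 0 (u - t), s + t ∈ Ioo t u := fun s hs ↦
    ⟨lt_add_of_pos_left _ hs.1, lt_sub_iff_add_lt.1 hs.2⟩
  have heq : EqOn (fun s ↦ γ (s + t)) (L.orbit (γ t).2) (Icc 0 (u - t)) :=
    eqOn_of_hasDerivAt_field (h.comp_add_const t).continuous.continuousOn
      (L.continuous_orbit _).continuousOn
      (fun s hs ↦ (h.comp_add_const t).left s (hneg _ (hmem s hs)))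
      (fun s _ ↦ L.hasDerivAt_orbit _ s) (by simp [L.orbit_zero, Prod.ext_iff, ht])
  refine ⟨sub_pos.2 htu, ?_, fun s hs ↦ ?_⟩
  · rw [← heq (right_mem_Icc.2 (sub_pos.2 htu).le)]
    simp [Prod.ext_iff, hu]
  · rw [← heq (Ioo_subset_Icc_self hs)]
    exact hneg _ (hmem s hs)

lemma IsExcursion.start_nonneg (he : IsExcursion γ t u) (h : S.IsClassicalSolution γ) :
    0 ≤ (γ t).2 := by
  by_contra! hy
  obtain ⟨s, hpos, hs⟩ :=
    ((h.eventually_pos (.inr ⟨he.2.1, hy⟩)).and (Ioo_mem_nhdsGT he.1)).exists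
  exact hpos.not_gt (he.2.2.2 s hs)

lemma IsClassicalSolution.exists_isExcursion_from (h : S.IsClassicalSolution γ) (hP : 0 < P)
    (hper : Function.Periodic γ P) (ht : (γ t).1 = 0) (hy : 0 < (γ t).2) :
    ∃ u, IsExcursion γ t u := by
  obtain ⟨u, hu, hzero, hneg⟩ := exists_first_return h.continuous.fst
    (h.eventually_neg (.inr ⟨ht, hy⟩)) (lt_add_of_pos_right t hP) (by rw [hper, ht])
  exact ⟨u, hu.1, ht, hzero, hneg⟩

lemma IsClassicalSolution.exists_isExcursion_to (h : S.IsClassicalSolution γ) (hP : 0 < P)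
    (hper : Function.Periodic γ P) (hu : (γ u).1 = 0) (hy : (γ u).2 < 0) :
    ∃ t, IsExcursion γ t u := by
  have hd : HasDerivAt (fun s ↦ (γ (-s)).1) (γ u).2 (-u) :=
    (HasDerivAt.scomp (h := Neg.neg) (g₁ := fun s ↦ (γ s).1) (-u)
      (by simpa using h.cross u hu) (hasDerivAt_neg (-u))).congr_deriv (by simp)
  obtain ⟨s, hs, hzero, hneg⟩ := exists_first_return (h.continuous.fst.comp continuous_neg)
    (eventually_neg_of_hasDerivAt_neg hd hy (by simpa using hu)) (lt_add_of_pos_right (-u) hP)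
    (by rw [Function.comp_apply, neg_add, neg_neg, ← sub_eq_add_neg, hper.sub_eq, hu])
  refine ⟨-s, neg_lt.1 hs.1, hzero, hu, fun r hr ↦ ?_⟩
  simpa using hneg (-r) ⟨neg_lt_neg hr.2, neg_lt.1 hr.1⟩

lemma IsClassicalSolution.exists_fst_eq_zero (h : (glue L R).IsClassicalSolution γ)
    (hL : L.T ≠ 0) (hR : R.T ≠ 0) (hP : 0 < P) (hper : Function.Periodic γ P)
    (hne : ∃ s t, γ s ≠ γ t) : ∃ t, (γ t).1 = 0 := by
  by_contra! hx
  obtain ⟨s, t, hst⟩ := hne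
  have hsame : ∀ t u, (γ t).1 < 0 → ¬ 0 < (γ u).1 := fun t u ht hu ↦ by
    obtain ⟨w, hw⟩ := mem_range_of_exists_le_of_exists_ge h.continuous.fst ⟨t, ht.le⟩ ⟨u, hu.le⟩
    exact hx w hw
  rcases (hx s).lt_or_gt with h0 | h0
  · exact hst <| eq_of_periodic_of_hasDerivAt_field L.discr_pos hL
      (fun t ↦ h.left t ((hx t).lt_of_le (not_lt.1 (hsame s t h0)))) hP.ne' hper s t
  · exact hst <| eq_of_periodic_of_hasDerivAt_field (by simpa [glue] using R.discr_pos)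
      (neg_ne_zero.2 hR)
      (fun t ↦ h.right t ((hx t).symm.lt_of_le (not_lt.1 fun ht ↦ hsame t s ht h0))) hP.ne' hper s t

lemma IsClassicalSolution.exists_highest_crossing (h : S.IsClassicalSolution γ) (hP : 0 < P)
    (hper : Function.Periodic γ P) (hne : ∀ t, γ t ≠ 0) (hzero : ∃ t, (γ t).1 = 0) :
    ∃ m, (γ m).1 = 0 ∧ 0 < (γ m).2 ∧ ∀ t, (γ t).1 = 0 → (γ t).2 ≤ (γ m).2 := by
  have hcompact : IsCompact (Icc 0 P ∩ {t | (γ t).1 = 0}) :=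
    isCompact_Icc.inter_right (isClosed_eq h.continuous.fst continuous_const)
  have hmem : ∀ t, (γ t).1 = 0 → ∃ s ∈ Icc 0 P ∩ {t | (γ t).1 = 0}, γ t = γ s := fun t ht ↦ by
    obtain ⟨s, hs, hts⟩ := hper.exists_mem_Ico₀ hP t
    exact ⟨s, ⟨Ico_subset_Icc_self hs, by rwa [Set.mem_ofPred_eq, ← hts]⟩, hts⟩
  obtain ⟨t, ht⟩ := hzero
  obtain ⟨m, ⟨-, hm⟩, hmax⟩ := hcompact.exists_isMaxOn ((hmem t ht).imp fun _ ↦ And.left)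
    h.continuous.snd.continuousOn
  have hle : ∀ t, (γ t).1 = 0 → (γ t).2 ≤ (γ m).2 := fun t ht ↦ by
    obtain ⟨s, hs, hts⟩ := hmem t ht
    exact hts ▸ hmax hs
  have hnonneg : 0 ≤ (γ m).2 := by
    by_contra! hneg
    obtain ⟨s, hs⟩ := h.exists_isExcursion_to hP hper hm hneg
    exact hneg.not_ge ((hs.start_nonneg h).trans (hle s hs.2.1))
  exact ⟨m, hm, hnonneg.lt_of_ne fun h0 ↦ hne m (Prod.ext hm h0.symm), hle⟩

lemma IsClassicalSolution.exists_defect_eq_zero_from_highest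
    (h : (glue L R).IsClassicalSolution γ) (hP : 0 < P) (hper : Function.Periodic γ P)
    (hne : ∀ t, γ t ≠ 0) {m : ℝ} (hm : (γ m).1 = 0) (hpos : 0 < (γ m).2)
    (hle : ∀ t, (γ t).1 = 0 → (γ t).2 ≤ (γ m).2) :
    ∃ b < 0, (0, b) ∈ range γ ∧ L.defect (γ m).2 b = 0 ∧
      ∃ v, 0 ≤ v ∧ v ≤ (γ m).2 ∧ R.defect v b = 0 := by
  obtain ⟨u, hu⟩ := h.exists_isExcursion_from hP hper hm hpos
  have harc := hu.isArc h
  have hneg : (γ u).2 < 0 := harc.nonpos.lt_of_ne fun h0 ↦ hne u (Prod.ext hu.2.2.1 h0)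
  obtain ⟨s, hs⟩ := h.mirror.exists_isExcursion_to (u := -u) hP (mirror_periodic hper)
    (by simpa [LienardPWL.mirror] using hu.2.2.1) (by simpa [LienardPWL.mirror] using hneg)
  have hv := hs.start_nonneg h.mirror
  have hdefect := (hs.isArc h.mirror).defect_eq_zero hv
  simp only [LienardPWL.mirror, neg_neg] at hv hdefect
  exact ⟨_, hneg, ⟨u, Prod.ext hu.2.2.1 rfl⟩, harc.defect_eq_zero hpos.le, _, hv,
    hle _ (neg_eq_zero.1 hs.2.1), hdefect⟩

theorem IsClassicalSolution.exists_mem_commonZeros (h : (glue L R).IsClassicalSolution γ)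
    (hP : 0 < P) (hper : Function.Periodic γ P) (hne : ∀ t, γ t ≠ 0) (hzero : ∃ t, (γ t).1 = 0) :
    ∃ p ∈ Focus.commonZeros L R, (0, p.1) ∈ range γ ∧ (0, p.2) ∈ range γ := by
  obtain ⟨m, hm, hpos, hle⟩ := h.exists_highest_crossing hP hper hne hzero
  obtain ⟨b, hb, hbγ, hLb, v, hv, hvm, hRb⟩ :=
    h.exists_defect_eq_zero_from_highest hP hper hne hm hpos hle
  obtain ⟨c, hc, -, hRc, w, hw, hwm, hLc⟩ :=
    h.mirror.exists_defect_eq_zero_from_highest hP (mirror_periodic hper)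
      (fun t ↦ mirror_ne_zero (hne _)) (m := -m) (by simpa [LienardPWL.mirror] using hm)
      (by simpa [LienardPWL.mirror] using hpos)
      fun t ht ↦ by simpa [LienardPWL.mirror] using hle _ (neg_eq_zero.1 ht)
  simp only [LienardPWL.mirror, neg_neg] at hRc hwm
  have hbc : b = c := le_antisymm (L.le_of_defect_eq_zero hw hwm hc.le hb.le hLc hLb)
    (R.le_of_defect_eq_zero hv hvm hb.le hc.le hRb hRc)
  exact ⟨((γ m).2, b), ⟨hpos, hb, hLb, hbc ▸ hRc⟩, ⟨m, Prod.ext hm rfl⟩, hbγ⟩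

end Excursion

/-! ### Gluing arcs -/

section Gluing

lemma lipschitzOnWith_of_norm_deriv_le_off_countable {E : Type*} [NormedAddCommGroup E]
    [NormedSpace ℝ E] [CompleteSpace E] {f : ℝ → E} (hf : Continuous f) {I s : Set ℝ}
    [I.OrdConnected] (hs : s.Countable) {C : ℝ≥0} (hd : ∀ t ∈ I \ s, DifferentiableAt ℝ f t)
    (hC : ∀ t ∈ I \ s, ‖deriv f t‖ ≤ C) : LipschitzOnWith C f I := by
  refine LipschitzOnWith.of_dist_le_mul fun x hx y hy ↦ ?_
  have hsub : uIcc y x ⊆ I := OrdConnected.uIcc_subset ‹_› hy hx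
  have hbound : ∀ᵐ t, t ∈ Ι y x → ‖deriv f t‖ ≤ C := by
    filter_upwards [hs.ae_notMem volume] with t hts ht
    exact hC t ⟨hsub (uIoc_subset_uIcc ht), hts⟩
  have hint : IntervalIntegrable (deriv f) volume y x :=
    intervalIntegrable_const.mono_fun (g := deriv f) (f := fun _ ↦ (C : ℝ))
      (stronglyMeasurable_deriv f).aestronglyMeasurable <| by
        filter_upwards [(ae_restrict_iff' measurableSet_uIoc).2 hbound] with t ht
        simpa using ht
  rw [dist_eq_norm, Real.dist_eq, ← integral_eq_of_hasDerivAt_off_countable f (deriv f) hs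
    hf.continuousOn (fun t ht ↦ (hd t ⟨hsub (Ioo_subset_Icc_self ht.1), ht.2⟩).hasDerivAt) hint]
  exact intervalIntegral.norm_integral_le_of_norm_le_const_ae hbound

lemma exists_periodic_gluing {X : Type*} [TopologicalSpace X] {α β : ℝ → X} (hα : Continuous α)
    (hβ : Continuous β) {τ Q : ℝ} (hτ : 0 < τ) (hτQ : τ < Q) (hαβ : α τ = β τ) (hβα : β Q = α 0) :
    ∃ γ : ℝ → X, Continuous γ ∧ Function.Periodic γ Q ∧ EqOn γ α (Icc 0 τ) ∧
      EqOn γ β (Ico τ Q) := by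
  have : Fact (0 < Q) := ⟨hτ.trans hτQ⟩
  let f : ℝ → X := fun t ↦ if t ≤ τ then α t else β t
  have hf : Continuous f :=
    hα.if_le hβ continuous_id continuous_const (by rintro t rfl; exact hαβ)
  have hfQ : f 0 = f Q := by simp [f, hτ.le, hτQ, hβα]
  have hγf : ∀ t ∈ Ico 0 Q, AddCircle.liftIco Q 0 f t = f t := fun t ↦
    AddCircle.liftIco_zero_coe_apply
  refine ⟨fun t ↦ AddCircle.liftIco Q 0 f t,
    (AddCircle.liftIco_zero_continuous hfQ hf.continuousOn).comp (AddCircle.continuous_mk' Q),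
    fun t ↦ by simp, fun t ht ↦ (hγf t ⟨ht.1, ht.2.trans_lt hτQ⟩).trans (if_pos ht.2),
    fun t ht ↦ (hγf t ⟨hτ.le.trans ht.1, ht.2⟩).trans ?_⟩
  rcases ht.1.eq_or_lt with rfl | hlt
  · exact (if_pos le_rfl).trans hαβ
  · exact if_neg hlt.not_ge

variable {L R : Focus} {S : LienardPWL} {γ : ℝ → ℝ × ℝ} {s : Set ℝ} {Q y₀ y₁ τ₁ τ₂ : ℝ}

lemma norm_le_of_mem_filippov {p v : ℝ × ℝ} (hv : v ∈ S.filippov p) :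
    ‖v‖ ≤ max ‖S.leftField p‖ ‖S.rightField p‖ := by
  rcases lt_trichotomy p.1 0 with hp | hp | hp
  · rw [filippov_of_neg hp, mem_singleton_iff] at hv
    exact hv ▸ le_max_left _ _
  · rw [filippov, if_neg hp.not_lt, if_neg hp.not_gt] at hv
    exact convexOn_univ_norm.le_max_of_mem_segment (mem_univ _) (mem_univ _) hv
  · rw [filippov_of_pos hp, mem_singleton_iff] at hv
    exact hv ▸ le_max_right _ _

lemma isSolution_of_hasDerivAt_off_countable (hγ : Continuous γ) (hs : s.Countable)
    (hd : ∀ t ∉ s, ∃ v ∈ S.filippov (γ t), HasDerivAt γ v t) : S.IsSolution γ := by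
  refine ⟨fun a b ↦ ?_, (hs.ae_notMem volume).mono hd⟩
  have hfield : Continuous fun t ↦ max ‖S.leftField (γ t)‖ ‖S.rightField (γ t)‖ :=
    ((continuous_field _ _ _).comp hγ).norm.max ((continuous_field _ _ _).comp hγ).norm
  obtain ⟨C, hC⟩ := isCompact_uIcc.bddAbove_image (hfield.continuousOn (s := uIcc a b))
  refine (lipschitzOnWith_of_norm_deriv_le_off_countable (C := C.toNNReal) hγ hs
    (fun t ht ↦ ?_) fun t ht ↦ ?_).absolutelyContinuousOnInterval
  · obtain ⟨v, -, hv⟩ := hd t ht.2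
    exact hv.differentiableAt
  · obtain ⟨v, hmem, hv⟩ := hd t ht.2
    rw [hv.deriv]
    exact ((norm_le_of_mem_filippov hmem).trans (hC ⟨t, ht.1, rfl⟩)).trans (Real.le_coe_toNNReal C)

lemma isSolution_of_periodic (hγ : Continuous γ) (hQ : 0 < Q) (hper : Function.Periodic γ Q)
    (hs : s.Countable) (hd : ∀ t ∈ Ico 0 Q \ s, ∃ v ∈ S.filippov (γ t), HasDerivAt γ v t) :
    S.IsSolution γ := by
  refine isSolution_of_hasDerivAt_off_countable hγ
    (s := ⋃ n : ℤ, (fun r ↦ r + n • Q) '' s) (countable_iUnion fun n ↦ hs.image _) fun t ht ↦ ?_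
  set r := toIcoMod hQ 0 t
  set n := toIcoDiv hQ 0 t
  have hrt : r + n • Q = t := toIcoMod_add_toIcoDiv_zsmul hQ 0 t
  have hshift : (fun u ↦ γ (u - n • Q)) = γ := funext (hper.zsmul n).sub_eq
  obtain ⟨v, hv, hderiv⟩ := hd r ⟨toIcoMod_mem_Ico' hQ t, fun hr ↦
    ht (mem_iUnion.2 ⟨n, r, hr, hrt⟩)⟩
  refine ⟨v, ?_, ?_⟩
  · rwa [← hrt, hper.zsmul n]
  · rw [← hshift]
    exact HasDerivAt.comp_sub_const t (n • Q) (by rwa [← hrt, add_sub_cancel_right])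

lemma isSolution_of_eqOn_Ioo (hγ : Continuous γ) (hQ : 0 < Q) (hper : Function.Periodic γ Q)
    {α β : ℝ → ℝ × ℝ} {τ : ℝ} (hγα : EqOn γ α (Ioo 0 τ)) (hγβ : EqOn γ β (Ioo τ Q))
    (hα : ∀ t ∈ Ioo 0 τ, (α t).1 < 0 ∧ HasDerivAt α (S.leftField (α t)) t)
    (hβ : ∀ t ∈ Ioo τ Q, 0 < (β t).1 ∧ HasDerivAt β (S.rightField (β t)) t) : S.IsSolution γ := by
  refine isSolution_of_periodic hγ hQ hper (toFinite {0, τ}).countable fun t ht ↦ ?_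
  have hcases : t ∈ Ioo 0 τ ∨ t ∈ Ioo τ Q := by grind
  rcases hcases with h | h
  · refine ⟨S.leftField (α t), ?_, (hα t h).2.congr_of_eventuallyEq <|
      hγα.eventuallyEq_of_mem (Ioo_mem_nhds h.1 h.2)⟩
    rw [hγα h, filippov_of_neg (hα t h).1, mem_singleton_iff]
  · refine ⟨S.rightField (β t), ?_, (hβ t h).2.congr_of_eventuallyEq <|
      hγβ.eventuallyEq_of_mem (Ioo_mem_nhds h.1 h.2)⟩
    rw [hγβ h, filippov_of_pos (hβ t h).1, mem_singleton_iff]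

lemma exists_isSolution_of_isArc (hL : L.IsArc y₀ y₁ τ₁) (hR : R.IsArc y₀ y₁ τ₂) :
    ∃ γ, (glue L R).IsSolution γ ∧ Function.Periodic γ (τ₁ + τ₂) ∧ γ 0 = (0, y₀) ∧
      γ τ₁ = (0, y₁) ∧ ∀ t, (γ t).1 = 0 → γ t = (0, y₀) ∨ γ t = (0, y₁) := by
  obtain ⟨hτ₁, hLy₁, hLneg⟩ := hL
  obtain ⟨hτ₂, hRy₁, hRneg⟩ := hR
  have hQ : 0 < τ₁ + τ₂ := add_pos hτ₁ hτ₂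
  let β : ℝ → ℝ × ℝ := fun t ↦ mirror (R.orbit y₀) (t - (τ₁ + τ₂))
  have hβ : ∀ t, HasDerivAt β ((glue L R).rightField (β t)) t := fun t ↦
    ((hasDerivAt_mirror (R.hasDerivAt_orbit _ _)).congr_deriv
      (rightField_glue_mirror (L := R) (R := L) _).symm).comp_sub_const t _
  have hβpos : ∀ t ∈ Ioo τ₁ (τ₁ + τ₂), 0 < (β t).1 := fun t ht ↦
    neg_pos.2 (hRneg _ ⟨by linarith [ht.2], by linarith [ht.1]⟩)
  obtain ⟨γ, hγ, hper, hγα, hγβ⟩ := exists_periodic_gluing (L.continuous_orbit y₀)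
    (continuous_iff_continuousAt.2 fun t ↦ (hβ t).continuousAt) hτ₁ (lt_add_of_pos_right τ₁ hτ₂)
    (by simp [β, mirror, hLy₁, hRy₁]) (by simp [β, mirror, Focus.orbit_zero])
  have hzero : γ 0 = (0, y₀) := (hγα (left_mem_Icc.2 hτ₁.le)).trans (L.orbit_zero y₀)
  have hτ : γ τ₁ = (0, y₁) := (hγα (right_mem_Icc.2 hτ₁.le)).trans hLy₁
  replace hγα := hγα.mono Ioo_subset_Icc_self
  replace hγβ := hγβ.mono Ioo_subset_Ico_self
  refine ⟨γ, isSolution_of_eqOn_Ioo hγ hQ hper hγα hγβ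
    (fun t ht ↦ ⟨hLneg t ht, L.hasDerivAt_orbit y₀ t⟩) fun t ht ↦ ⟨hβpos t ht, hβ t⟩,
    hper, hzero, hτ, fun t ht ↦ ?_⟩
  obtain ⟨r, hr, htr⟩ := hper.exists_mem_Ico₀ hQ t
  rw [htr] at ht ⊢
  have hcases : r = 0 ∨ r = τ₁ ∨ r ∈ Ioo 0 τ₁ ∨ r ∈ Ioo τ₁ (τ₁ + τ₂) := by grind
  rcases hcases with rfl | rfl | h | h
  · exact .inl hzero
  · exact .inr hτ
  · exact absurd (hγα h ▸ ht) (hLneg r h).ne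
  · exact absurd (hγβ h ▸ ht) (hβpos r h).ne'

end Gluing

/-! ### The limit cycle -/

section LimitCycle

variable {L R : Focus} {S : LienardPWL}

lemma isCrossingPoint_iff {p : ℝ × ℝ} : S.IsCrossingPoint p ↔ p.1 = 0 ∧ p ≠ 0 := by
  refine and_congr_right fun hp ↦ ?_
  have hp : p.1 = 0 := hp
  simp [leftField, rightField, field, hp, Prod.ext_iff]

/-- The points off the switching line, together with the points of the line whose height is a
positive element of `u` or a negative element of `v`. -/
def crossingNhd (u v : Set ℝ) : Set (ℝ × ℝ) := {p | p.1 ≠ 0 ∨ p.2 ∈ u ∩ Ioi 0 ∪ v ∩ Iio 0}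

lemma isOpen_crossingNhd {u v : Set ℝ} (hu : IsOpen u) (hv : IsOpen v) :
    IsOpen (crossingNhd u v) :=
  (isOpen_ne.preimage continuous_fst).union
    (((hu.inter isOpen_Ioi).union (hv.inter isOpen_Iio)).preimage continuous_snd)

lemma ne_zero_of_mem_crossingNhd {u v : Set ℝ} {p : ℝ × ℝ} (hp : p ∈ crossingNhd u v) : p ≠ 0 := by
  rintro rfl
  simp [crossingNhd] at hp

lemma exists_mem_commonZeros_of_range_subset_crossingNhd (hL : L.T ≠ 0) (hR : R.T ≠ 0)
    {γ : ℝ → ℝ × ℝ} (h : (glue L R).IsClassicalSolution γ) {P : ℝ} (hP : 0 < P)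
    (hper : Function.Periodic γ P) (hne : ∃ s t, γ s ≠ γ t) {u v : Set ℝ}
    (hU : range γ ⊆ crossingNhd u v) :
    ∃ p ∈ Focus.commonZeros L R, p ∈ u ×ˢ v ∧ (0, p.1) ∈ range γ := by
  have hγ : ∀ t, γ t ≠ 0 := fun t ↦ ne_zero_of_mem_crossingNhd (hU ⟨t, rfl⟩)
  obtain ⟨p, hp, hp₁, hp₂⟩ := h.exists_mem_commonZeros hP hper hγ
    (h.exists_fst_eq_zero hL hR hP hper hne)
  have hpu := (hU hp₁).resolve_left (not_not.2 rfl)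
  have hpv := (hU hp₂).resolve_left (not_not.2 rfl)
  exact ⟨p, hp, ⟨(hpu.resolve_right fun hv ↦ hp.1.not_gt hv.2).1,
    (hpv.resolve_left fun hu ↦ hp.2.1.not_gt hu.2).1⟩, hp₁⟩

theorem exists_isLimitCycle (hL : L.T ≠ 0) (hR : R.T ≠ 0)
    (h : Focus.HasIsolatedCommonZero L R) : ∃ Γ, (glue L R).IsLimitCycle Γ := by
  obtain ⟨⟨y₀, y₁⟩, ⟨hy₀, hy₁, hLd, hRd⟩, hiso⟩ := h
  obtain ⟨u, v, hu, hy₀u, hv, hy₁v, huv⟩ := mem_nhds_prod_iff'.1 hiso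
  obtain ⟨τ₁, hLarc⟩ := L.exists_isArc hy₀ hy₁ hLd
  obtain ⟨τ₂, hRarc⟩ := R.exists_isArc hy₀ hy₁ hRd
  obtain ⟨γ, hsol, hper, hγ0, hγτ, hγline⟩ := exists_isSolution_of_isArc hLarc hRarc
  have hP : 0 < τ₁ + τ₂ := add_pos hLarc.1 hRarc.1
  have hsub : range γ ⊆ crossingNhd u v := by
    rintro _ ⟨t, rfl⟩
    refine or_iff_not_imp_left.2 fun ht ↦ ?_
    rcases hγline t (not_not.1 ht) with h | h <;> rw [h]
    exacts [.inl ⟨hy₀u, hy₀⟩, .inr ⟨hy₁v, hy₁⟩]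
  have hne : ∀ t, γ t ≠ 0 := fun t ↦ ne_zero_of_mem_crossingNhd (hsub ⟨t, rfl⟩)
  refine ⟨range γ, ⟨⟨γ, _, hsol, hP, hper, ⟨0, τ₁, ?_⟩, rfl⟩, ⟨_, ⟨0, hγ0⟩, rfl⟩, ?_⟩,
    crossingNhd u v, isOpen_crossingNhd hu hv, hsub, ?_⟩
  · simp [hγ0, hγτ, (hy₁.trans hy₀).ne']
  · rintro _ ⟨⟨t, rfl⟩, ht⟩
    exact isCrossingPoint_iff.2 ⟨ht, hne t⟩
  · rintro _ ⟨δ, Q, hδ, hQ, hδper, hδne, rfl⟩ hδU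
    obtain ⟨p, hp, hpuv, hpδ⟩ := exists_mem_commonZeros_of_range_subset_crossingNhd hL hR
      hδ.isClassicalSolution hQ hδper hδne hδU
    obtain rfl : p = (y₀, y₁) := huv hpuv hp
    exact (hsol.isClassicalSolution.range_eq hδ.isClassicalSolution hne hP hQ hper hδper
      ⟨0, hγ0⟩ hpδ).symm

end LimitCycle

/-! ### Monodromic singularities -/

section Monodromic

variable {T D a : ℝ} {S : LienardPWL}

lemma spectrum_linPart_eq_empty (hf : 0 < 4 * D - T ^ 2) : spectrum ℝ (linPart T D) = ∅ := by
  refine eq_empty_iff_forall_notMem.2 fun μ hμ ↦ ?_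
  have hdet : (algebraMap ℝ (Matrix (Fin 2) (Fin 2) ℝ) μ - linPart T D).det = (μ - T) * μ + D := by
    rw [Matrix.det_fin_two, Matrix.algebraMap_eq_diagonal]
    simp [linPart]
  rw [spectrum.mem_iff, Matrix.isUnit_iff_isUnit_det, isUnit_iff_ne_zero, not_not, hdet] at hμ
  nlinarith [sq_nonneg (2 * μ - T)]

lemma isFocusOrCenter (hf : 0 < 4 * D - T ^ 2) :
    IsFocusOrCenter T D a (a / D, T * (a / D)) := by
  have hD : D ≠ 0 := by nlinarith [sq_nonneg T]
  refine ⟨?_, spectrum_linPart_eq_empty hf⟩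
  ext <;> simp [field, mul_div_cancel₀, hD]

lemma aL_pos_or_aR_neg (hL : 0 < 4 * S.DL - S.TL ^ 2) (hR : 0 < 4 * S.DR - S.TR ^ 2)
    (haL : S.aL ≠ 0) (haR : S.aR ≠ 0) (hmono : ∃! p : ℝ × ℝ, S.IsMonodromicSingularity p) :
    0 < S.aL ∨ S.aR < 0 := by
  by_contra! h
  have hxL : S.aL / S.DL < 0 :=
    div_neg_of_neg_of_pos (h.1.lt_of_ne haL) (by nlinarith [sq_nonneg S.TL])
  have hxR : 0 < S.aR / S.DR := div_pos (h.2.lt_of_ne haR.symm) (by nlinarith [sq_nonneg S.TR])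
  have heq := hmono.unique (.inl ⟨hxL, isFocusOrCenter hL⟩)
    (.inr (.inl ⟨hxR, isFocusOrCenter hR⟩))
  exact (hxL.trans hxR).ne (congrArg Prod.fst heq)

end Monodromic

end LienardPWL

theorem mainTheorem4 (S : LienardPWL)
    (hT : S.TL * S.TR < 0)
    (hc0 : S.c0 ≠ 0)
    (hyL : S.ForwardHalfMapExists)
    (hyR : S.BackwardHalfMapExists)
    (hmono : ∃! p : ℝ × ℝ, S.IsMonodromicSingularity p)
    (hL : 0 < 4 * S.DL - S.TL ^ 2)
    (hR : 0 < 4 * S.DR - S.TR ^ 2)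
    (hξ : 0 < S.xi * S.cInf) :
    ∃ Γ : Set (ℝ × ℝ), S.IsLimitCycle Γ := by
  obtain ⟨haR, haL⟩ := mul_ne_zero_iff.1 (left_ne_zero_of_mul hc0)
  obtain ⟨hTL, hTR⟩ := mul_ne_zero_iff.1 hT.ne
  let L : LienardPWL.Focus := ⟨S.TL, S.DL, S.aL, hL, haL⟩
  let R : LienardPWL.Focus := ⟨-S.TR, S.DR, -S.aR, by rwa [neg_sq], neg_ne_zero.2 haR⟩
  have hS : LienardPWL.glue L R = S := by simp [LienardPWL.glue, L, R]
  have hzero : LienardPWL.Focus.HasIsolatedCommonZero L R := by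
    refine LienardPWL.Focus.hasIsolatedCommonZero (by simpa [L, R] using hT)
      ((LienardPWL.aL_pos_or_aR_neg hL hR haL haR hmono).imp_right neg_pos.2) ?_
    exact hξ.trans_eq (by simp only [LienardPWL.xi, LienardPWL.cInf, L, R]; ring)
  exact hS ▸ LienardPWL.exists_isLimitCycle hTL (neg_ne_zero.2 hTR) hzero
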